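/- Let $\mathbb{K}$ be an algebraically closed field of arbitrary characteristic and let $X\subset\mathbb{P}^2_{\mathbb{K}}$ be a finite closed subscheme of degree $d=\dim_{\mathbb{K}}\mathrm{H}^0(\mathscr{O}_X)$. Let $I_X\subset S=\mathbb{K}[x_0,x_1,x_2]$ be the saturated homogeneous ideal of $X$. The regularity $\mathrm{reg}(X)$ is the infimum of all integers $r$ such that, for every $i\ge 0$, the $i$-th syzygy module of $I_X$ (with respect to its minimal graded free resolution over $S$, the $0$-th one being $I_X$ itself) is generated in degrees at most $r+i$. Then: 1. $\mathrm{reg}(X)\le d$. 2. If $\mathrm{reg}(X)=d$, then there is a line $M\subset\mathbb{P}^2_{\mathbb{K}}$ such that $X$ lies on $M$ (that is, $X$ is a closed subscheme of $M$). 3. If $\mathrm{reg}(X)=d-1$ and $d\neq 4$, then there is a line $M\subset\mathbb{P}^2_{\mathbb{K}}$ such that the scheme-theoretic intersection $M\cap X$ has degree $d-1$. -/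

import Mathlib

open AlgebraicGeometry CategoryTheory

universe u

noncomputable section

/-! ### Castelnuovo-Mumford regularity of a homogeneous ideal -/

/-- A minimal graded free resolution
`⋯ ⟶ F₂ ⟶ F₁ ⟶ F₀ ⟶ I ⟶ 0` of an ideal `I` of the standard graded ring
`S = K[x_s : s ∈ σ]`, where `Fᵢ = ⨁ⱼ S(-deg i j)`. The map `F₀ ⟶ I` sends the `j`-th basis vector
to `gen j`, the map `Fᵢ₊₁ ⟶ Fᵢ` is given by the matrix `diff i`. -/
structure MinimalGradedResolution {K : Type u} [Field K] {σ : Type}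
    (I : Ideal (MvPolynomial σ K)) where
  rank : ℕ → ℕ
  deg : ∀ i, Fin (rank i) → ℕ
  gen : Fin (rank 0) → MvPolynomial σ K
  diff : ∀ i, Matrix (Fin (rank i)) (Fin (rank (i + 1))) (MvPolynomial σ K)
  /-- `F₀ ⟶ I` is homogeneous of degree zero. -/
  gen_homogeneous : ∀ j, (gen j).IsHomogeneous (deg 0 j)
  /-- `Fᵢ₊₁ ⟶ Fᵢ` is homogeneous of degree zero: the `(j, k)` entry is a form of degree
  `deg (i + 1) k - deg i j`, which is zero if that number is negative. -/
  diff_homogeneous : ∀ i j k, diff i j k ≠ 0 →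
    ∃ e : ℕ, deg (i + 1) k = deg i j + e ∧ (diff i j k).IsHomogeneous e
  /-- `F₀ ⟶ I` is onto. -/
  span_gen : Ideal.span (Set.range gen) = I
  /-- Exactness at `F₀`. -/
  exact_zero : ∀ v : Fin (rank 0) → MvPolynomial σ K,
    ∑ j, v j * gen j = 0 ↔ ∃ w, (diff 0).mulVec w = v
  /-- Exactness at `Fᵢ₊₁`. -/
  exact_succ : ∀ i (v : Fin (rank (i + 1)) → MvPolynomial σ K),
    (diff i).mulVec v = 0 ↔ ∃ w, (diff (i + 1)).mulVec w = v
  /-- Minimality: all matrix entries lie in the ideal generated by the variables. -/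
  minimal : ∀ i j k, MvPolynomial.constantCoeff (diff i j k) = 0

/-- `I` is `r`-regular: for all `i`, the `i`-th syzygy module of `I` (that is, `I` itself for `i = 0`
and the image of `Fᵢ ⟶ Fᵢ₋₁` for `i ≥ 1`, where `F` is the minimal graded free resolution) is
generated in degrees at most `r + i`. By minimality the images of the basis vectors of `Fᵢ` are
minimal generators of the `i`-th syzygy module. -/
def IsRegularIdeal {K : Type u} [Field K] {σ : Type}
    (I : Ideal (MvPolynomial σ K)) (r : ℤ) : Prop :=
  ∃ F : MinimalGradedResolution I, ∀ i j, (F.deg i j : ℤ) ≤ r + i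

/-- The regularity of `I`: the infimum of all integers `r` such that `I` is `r`-regular, taken
in `[-∞, ∞]` (so that it is `∞` if there is no such `r`). -/
def idealReg {K : Type u} [Field K] {σ : Type} (I : Ideal (MvPolynomial σ K)) : EReal :=
  ⨅ (r : ℤ) (_ : IsRegularIdeal I r), ((r : ℝ) : EReal)

/-! ### The projective plane and its closed subschemes -/

namespace Plane

variable (K : Type u) [Field K]

/-- The homogeneous coordinate ring `K[x₀, x₁, x₂]` of the plane. -/
abbrev CoordRing : Type u := MvPolynomial (Fin 3) K

/-- The standard grading of the coordinate ring. -/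
abbrev grading : ℕ → Submodule K (CoordRing K) := MvPolynomial.homogeneousSubmodule (Fin 3) K

instance gradingAlgebra : GradedAlgebra (grading K) := MvPolynomial.gradedAlgebra

/-- The projective plane `Proj K[x₀, x₁, x₂]`. -/
abbrev P2 : Scheme.{u} := Proj (grading K)

/-- The structure morphism of the projective plane. -/
def toSpecK : P2 K ⟶ Spec (CommRingCat.of K) :=
  Proj.toSpecZero (grading K) ≫ Spec.map (CommRingCat.ofHom (algebraMap K (grading K 0)))

/-- A closed subscheme of the plane, given by its quasi-coherent ideal sheaf. The scheme itself is
`X.subscheme`, and its closed immersion is `X.subschemeι`. -/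
abbrev ClosedSubscheme : Type u := (P2 K).IdealSheafData

variable {K}

theorem X_mem_grading (i : Fin 3) : (MvPolynomial.X i : CoordRing K) ∈ grading K 1 :=
  MvPolynomial.isHomogeneous_X K i

/-- The standard affine chart `D₊(xᵢ)`. -/
abbrev chart (i : Fin 3) : (P2 K).affineOpens :=
  ⟨Proj.basicOpen (grading K) (MvPolynomial.X i),
    Proj.isAffineOpen_basicOpen (grading K) _ (X_mem_grading i) one_pos⟩

/-- The function `f / xᵢⁿ`, where `f` is a form of degree `n`, as an element of the
degree zero part of `K[x₀, x₁, x₂][1 / xᵢ]`. -/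
def dehomogenize (i : Fin 3) {n : ℕ} (f : CoordRing K) (hf : f ∈ grading K n) :
    HomogeneousLocalization.Away (grading K) (MvPolynomial.X i : CoordRing K) :=
  HomogeneousLocalization.Away.mk (grading K) (X_mem_grading i) n f
    (by rwa [smul_eq_mul, mul_one])

namespace ClosedSubscheme

/-- The ideal of `X` in the coordinate ring of the chart `D₊(xᵢ)`, where that coordinate ring is
identified with the degree zero part of `K[x₀, x₁, x₂][1 / xᵢ]`. -/
def chartIdeal (X : ClosedSubscheme K) (i : Fin 3) :
    Ideal (HomogeneousLocalization.Away (grading K) (MvPolynomial.X i : CoordRing K)) :=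
  (X.ideal (chart i)).comap (Proj.awayToSection (grading K) (MvPolynomial.X i)).hom

/-- The saturated homogeneous ideal of `X`: it is generated by the forms `f` that vanish on `X`,
that is, for which `f / xᵢⁿ` (`n` the degree of `f`) is in the ideal of `X` on each chart. -/
def homogeneousIdeal (X : ClosedSubscheme K) : Ideal (CoordRing K) :=
  Ideal.span {f | ∃ (n : ℕ) (hf : f ∈ grading K n), ∀ i, dehomogenize i f hf ∈ X.chartIdeal i}

/-- The regularity of `X` is that of its saturated homogeneous ideal. -/
def reg (X : ClosedSubscheme K) : EReal := idealReg X.homogeneousIdeal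

/-- The structure morphism of `X`. -/
def structureMap (X : ClosedSubscheme K) : X.subscheme ⟶ Spec (CommRingCat.of K) :=
  X.subschemeι ≫ toSpecK K

/-- `X` is a finite scheme (over `K`). -/
def IsFiniteScheme (X : ClosedSubscheme K) : Prop := IsFinite X.structureMap

/-- The homomorphism from `K` to the ring of global functions on `X`. -/
def scalars (X : ClosedSubscheme K) : K →+* Γ(X.subscheme, ⊤) :=
  ((Scheme.ΓSpecIso (CommRingCat.of K)).inv ≫ X.structureMap.appTop).hom

/-- The degree of a finite scheme `X`: the dimension over `K` of the space of global functions. -/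
def degree (X : ClosedSubscheme K) : ℕ :=
  letI : Module K Γ(X.subscheme, ⊤) := X.scalars.toModule
  Module.finrank K Γ(X.subscheme, ⊤)

/-- `X` lies on `Y`, i.e. `X` is a closed subscheme of `Y`: the ideal of `Y` is contained in
that of `X`. -/
def LiesOn (X Y : ClosedSubscheme K) : Prop :=
  Scheme.IdealSheafData.ideal Y ≤ Scheme.IdealSheafData.ideal X

/-- The scheme-theoretic intersection, whose ideal is the sum of the two ideals. -/
def inter (X Y : ClosedSubscheme K) : ClosedSubscheme K :=
  (X ⊔ Y : (P2 K).IdealSheafData)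

/-- `M` is a line: the closed subscheme defined by a nonzero linear form `ℓ`, so that its ideal
on the chart `D₊(xᵢ)` is generated by `ℓ / xᵢ`. -/
def IsLine (M : ClosedSubscheme K) : Prop :=
  ∃ (l : CoordRing K) (hl : l ∈ grading K 1), l ≠ 0 ∧
    ∀ i, M.chartIdeal i = Ideal.span {dehomogenize i l hl}

end ClosedSubscheme

end Plane

end

/-! ### Ideals of a closed subscheme on affine charts -/

noncomputable section
namespace Plane
variable {K : Type u} [Field K]
open HomogeneousLocalization

/-! Since K is infinite and X has finitely many points, some linear form `l` vanishes at no point of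
X. Dividing forms by powers of `l` gives a surjection δ from S onto B = Γ(X) with δ(l) = 1, and I_X
is generated by the forms that δ kills (`mem_idealOn_iff`, `homogeneousIdeal_eq_formsIdeal`). What
remains concerns the subspaces V_n = δ(S_n) of B, where dim B = d.

As δ(l) = 1 and V_n = V_1^n, the V_n increase, strictly until they reach B. So dim V_t ≥ t + c
forces V_{d-c} = B (`values_eq_top`). If V_t = B, then `l` is a nonzerodivisor modulo I_X and every
form of degree > t lies in lS + I_X; a Koszul argument then bounds the degrees of generators by t +
1, those of first syzygies by t + 2, and kills the second syzygies
(`isRegularIdeal_of_nonzerodivisor`). Hence dim V_t ≥ t + c gives reg(X) ≤ d - c + 1.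

For d > 0, dim V_0 = 1 gives c = 1 and part 1. If X is on no line, dim V_1 = 3 gives c = 2, hence
part 2. In part 3, X is on no line, since otherwise B is generated by one element, whose homogenized
minimal polynomial forces reg(X) ≥ d (`finrank_le_of_isRegularIdeal`). If d = 3, then V_1 = B and a
socle element of B is the value of a linear form m. If d ≥ 5, either dim V_2 ≥ 5 or dim V_3 ≥ 6
would give c = 3 and reg(X) ≤ d - 2. Otherwise I_X contains two independent conics and at most a
five-dimensional space of cubics, so the conics have a linear syzygy and are am and bm for linear
forms a, b, m. The basis l, a, b of linear forms acts on δ(m) by 1, 0, 0. In both cases δ(m)B =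
Kδ(m) is one-dimensional, so the line m = 0 cuts X in degree d - 1. -/

lemma specMap_awayToSection_awayι {m : ℕ} {f : CoordRing K} (hf : f ∈ grading K m) (hm : 0 < m) :
    Spec.map (Proj.awayToSection (grading K) f) ≫ Proj.awayι (grading K) f hf hm =
      (Proj.isAffineOpen_basicOpen (grading K) f hf hm).fromSpec := by
  have : IsIso (Proj.awayToSection (grading K) f) := by
    rw [← Proj.basicOpenIsoAway_hom _ _ hf hm]; infer_instance
  rw [Proj.awayι, IsAffineOpen.fromSpec, ← Category.assoc]
  congr 1
  rw [Iso.comp_inv_eq, Proj.basicOpenIsoSpec_hom, Proj.basicOpenToSpec, ← Category.assoc]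
  rw [← IsAffineOpen.isoSpec_hom (Proj.isAffineOpen_basicOpen (grading K) f hf hm), Iso.inv_hom_id,
    Category.id_comp]

/-- The affine open `D₊(f)`. -/
abbrev opens {m : ℕ} {f : CoordRing K} (hf : f ∈ grading K m) (hm : 0 < m) : (P2 K).affineOpens :=
  ⟨Proj.basicOpen (grading K) f, Proj.isAffineOpen_basicOpen (grading K) f hf hm⟩

/-- The ideal of `Y` in the degree zero part of `K[x₀, x₁, x₂][1 / f]`. -/
def ClosedSubscheme.idealOn (Y : ClosedSubscheme K) {m : ℕ} {f : CoordRing K}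
    (hf : f ∈ grading K m) (hm : 0 < m) : Ideal (Away (grading K) f) :=
  (Y.ideal (opens hf hm)).comap (Proj.awayToSection (grading K) f).hom

/-- The constants in the degree zero part of `K[x₀, x₁, x₂][1 / f]`. -/
def awayConst (f : CoordRing K) : K →+* Away (grading K) f :=
  (fromZeroRingHom (grading K) (Submonoid.powers f)).comp (algebraMap K (grading K 0))

lemma awayToSection_bijective {m : ℕ} {f : CoordRing K} (hf : f ∈ grading K m) (hm : 0 < m) :
    Function.Bijective (Proj.awayToSection (grading K) f).hom := by
  rw [← Proj.basicOpenIsoAway_hom _ _ hf hm]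
  exact (Proj.basicOpenIsoAway (grading K) f hf hm).commRingCatIsoToRingEquiv.bijective

lemma idealOn_mul (Y : ClosedSubscheme K) {m n : ℕ} {f g x : CoordRing K} (hf : f ∈ grading K m)
    (hg : g ∈ grading K n) (hx : x = f * g) (hm : 0 < m) (hxm : x ∈ grading K (m + n)) :
    Y.idealOn hxm (Nat.add_pos_left hm n) = (Y.idealOn hf hm).map (awayMap (grading K) hg hx) := by
  have h1 := awayToSection_bijective hf hm
  have h2 := awayToSection_bijective hxm (Nat.add_pos_left hm n)
  have hle : opens hxm (Nat.add_pos_left hm n) ≤ opens hf hm :=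
    Proj.basicOpen_mono _ _ _ ⟨_, hx⟩
  have h3 := Y.map_ideal hle
  have h4 := congrArg CommRingCat.Hom.hom (Proj.awayMap_awayToSection (grading K) hg hx)
  have h5 : Y.ideal (opens hf hm) =
      (Y.idealOn hf hm).map (Proj.awayToSection (grading K) f).hom :=
    (Ideal.map_comap_of_surjective _ h1.surjective _).symm
  rw [ClosedSubscheme.idealOn, ← h3, h5, Ideal.map_map]
  rw [CommRingCat.hom_comp, CommRingCat.hom_comp, CommRingCat.hom_ofHom] at h4
  rw [show ((P2 K).presheaf.map (homOfLE hle).op).hom.comp (Proj.awayToSection (grading K) f).hom =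
    (Proj.awayToSection (grading K) x).hom.comp (awayMap (grading K) hg hx) from h4.symm,
    ← Ideal.map_map, Ideal.comap_map_of_bijective _ h2]

lemma mem_idealOn_mul (Y : ClosedSubscheme K) {m n : ℕ} {f g x : CoordRing K} (hf : f ∈ grading K m)
    (hg : g ∈ grading K n) (hx : x = f * g) (hm : 0 < m) (hxm : x ∈ grading K (m + n))
    (a : Away (grading K) f) :
    awayMap (grading K) hg hx a ∈ Y.idealOn hxm (Nat.add_pos_left hm n) ↔
      ∃ k, (Away.isLocalizationElem hf hg) ^ k * a ∈ Y.idealOn hf hm := by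
  rw [idealOn_mul Y hf hg hx hm hxm]
  let := (awayMap (grading K) hg hx).toAlgebra
  have := Away.isLocalization_mul hf hg hx hm.ne'
  change algebraMap _ (Away (grading K) x) a ∈ Ideal.map (algebraMap _ _) _ ↔ _
  rw [IsLocalization.algebraMap_mem_map_algebraMap_iff (Submonoid.powers (Away.isLocalizationElem hf hg))]
  simp [Submonoid.mem_powers_iff]

lemma awayToSection_const {m : ℕ} {f : CoordRing K} (hf : f ∈ grading K m) (hm : 0 < m) :
   (Scheme.ΓSpecIso (CommRingCat.of K)).inv ≫ (toSpecK K).appTop ≫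
     (P2 K).presheaf.map (homOfLE (le_top : Proj.basicOpen (grading K) f ≤ ⊤)).op =
   CommRingCat.ofHom (awayConst f) ≫ Proj.awayToSection (grading K) f := by
  have key : (opens hf hm).2.fromSpec ≫ toSpecK K =
      Spec.map (CommRingCat.ofHom (awayConst f) ≫ Proj.awayToSection (grading K) f) := by
    rw [← specMap_awayToSection_awayι hf hm, toSpecK, Category.assoc, Proj.awayι_toSpecZero_assoc,
      ← Spec.map_comp, ← Spec.map_comp]
    rfl
  have := congrArg Scheme.Hom.appTop key
  have h1 := (opens hf hm).2.fromSpec_app_of_le ⊤ le_top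
  change (opens hf hm).2.fromSpec.appTop = _ at h1
  rw [Scheme.Hom.comp_appTop, h1, ← Iso.cancel_iso_inv_left (Scheme.ΓSpecIso (CommRingCat.of K)),
    ← Scheme.ΓSpecIso_inv_naturality] at this
  rw [← cancel_mono (Scheme.ΓSpecIso Γ(P2 K, Proj.basicOpen (grading K) f)).inv, ← this]
  simp only [Category.assoc]
  congr 3

lemma subscheme_appLE (Y : ClosedSubscheme K) (U : (P2 K).affineOpens) (V : Y.subscheme.Opens)
    (h : V = Y.subschemeι ⁻¹ᵁ U) :
    Function.Surjective (Y.subschemeι.appLE U V h.le).hom ∧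
      RingHom.ker (Y.subschemeι.appLE U V h.le).hom = Y.ideal U := by
  subst h
  rw [Scheme.Hom.appLE_eq_app]
  exact ⟨Y.subschemeι_app_surjective U, Y.ker_subschemeι_app U⟩


lemma fromSpec_apply {m : ℕ} {f : CoordRing K} (hf : f ∈ grading K m) (hm : 0 < m)
    (q : Spec Γ(P2 K, Proj.basicOpen (grading K) f)) :
    (opens hf hm).2.fromSpec q = Proj.awayι (grading K) f hf hm
      (Spec.map (Proj.awayToSection (grading K) f) q) := by
  rw [← Scheme.Hom.comp_apply, specMap_awayToSection_awayι]

/-- A maximal ideal containing both would be a point of `Y` outside D₊(l). So on each chart `l`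
becomes a unit modulo the ideal of `Y`. -/
lemma idealOn_sup_span_eq_top (Y : ClosedSubscheme K) {l : CoordRing K} {n : ℕ}
    (hl : l ∈ grading K n) (hn : 0 < n)
    (hY : ∀ y : Y.subscheme, Y.subschemeι y ∈ Proj.basicOpen (grading K) l)
    {m : ℕ} {f : CoordRing K} (hf : f ∈ grading K m) (hm : 0 < m) :
    Ideal.span {Away.isLocalizationElem hf hl} ⊔ Y.idealOn hf hm = ⊤ := by
  by_contra hne
  obtain ⟨p, hp, hle⟩ := Ideal.exists_le_maximal _ hne
  have hb := awayToSection_bijective hf hm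
  let e := RingEquiv.ofBijective _ hb
  let q : PrimeSpectrum (Away (grading K) f) := ⟨p, hp.isPrime⟩
  let q' : PrimeSpectrum Γ(P2 K, Proj.basicOpen (grading K) f) := PrimeSpectrum.comap (e.symm : _ →+* _) q
  have hq : Spec.map (Proj.awayToSection (grading K) f) q' = q := by
    apply PrimeSpectrum.ext
    ext a
    change e.symm (e a) ∈ p ↔ a ∈ p
    simp
  have hz : q' ∈ PrimeSpectrum.zeroLocus (Y.ideal (opens hf hm) : Set _) := by
    intro s hs
    change e.symm s ∈ p
    refine hle (Ideal.mem_sup_right ?_)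
    change e (e.symm s) ∈ Y.ideal (opens hf hm)
    rw [e.apply_symm_apply]
    exact hs
  have hx := (opens hf hm).2.fromSpec_image_zeroLocus (Y.ideal (opens hf hm) : Set _) ▸
    Set.mem_image_of_mem (opens hf hm).2.fromSpec hz
  rw [← Scheme.IdealSheafData.coe_support_inter] at hx
  have hx1 := hx.1
  rw [← Scheme.IdealSheafData.range_subschemeι] at hx1
  obtain ⟨y, hy⟩ := hx1
  have hyl := hY y
  rw [hy] at hyl
  have hyl2 := Eq.subst (motive := fun z => z ∈ Proj.basicOpen (grading K) l)
    (fromSpec_apply hf hm q') hyl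
  rw [hq] at hyl2
  have h2 : q ∈ Proj.awayι (grading K) f hf hm ⁻¹ᵁ Proj.basicOpen (grading K) l := hyl2
  rw [Proj.awayι_preimage_basicOpen (grading K) hf hm hl hn] at h2
  exact h2 (hle (Ideal.mem_sup_left (Ideal.mem_span_singleton_self _)))

/-- The function `F / lⁿ`, where `F` is a form of degree `n`. -/
def frac {l : CoordRing K} (hl : l ∈ grading K 1) {n : ℕ} {F : CoordRing K} (hF : F ∈ grading K n) :
    Away (grading K) l :=
  Away.mk (grading K) hl n F (by rwa [smul_eq_mul, mul_one])

/-- On D₊(lg) the two fractions differ by a unit; descending to D₊(g) costs a power of l/g. -/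
lemma frac_mem_of_frac_mem (Y : ClosedSubscheme K) {l g : CoordRing K} (hl : l ∈ grading K 1)
    (hg : g ∈ grading K 1) {n : ℕ} {F : CoordRing K} (hF : F ∈ grading K n)
    (h : frac hl hF ∈ Y.idealOn hl one_pos) :
    ∃ k, frac hg hl ^ k * frac hg hF ∈ Y.idealOn hg one_pos := by
  have hx : l * g ∈ grading K (1 + 1) := SetLike.mul_mem_graded hl hg
  have h1 : awayMap (grading K) hg rfl (frac hl hF) ∈ Y.idealOn hx (Nat.add_pos_left one_pos 1) := by
    rw [idealOn_mul Y hl hg rfl one_pos hx]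
    exact Ideal.mem_map_of_mem _ h
  have h2 : awayMap (grading K) hl (mul_comm l g) (frac hg hF) ∈
      Y.idealOn hx (Nat.add_pos_left one_pos 1) := by
    -- The unit (l/g)^n, written with denominator (lg)^n.
    have h3 : l ^ (2 * n) ∈ grading K (n • 2) := by
      have := SetLike.pow_mem_graded (2 * n) hl
      simpa [mul_comm] using this
    convert Ideal.mul_mem_left _ (Away.mk (grading K) hx n (l ^ (2 * n)) h3) h1 using 1
    rw [HomogeneousLocalization.ext_iff_val, HomogeneousLocalization.val_mul, frac, frac,
      awayMap_mk, awayMap_mk, Away.val_mk, Away.val_mk, Away.val_mk, Localization.mk_mul,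
      Localization.mk_eq_mk_iff, Localization.r_iff_exists]
    refine ⟨1, ?_⟩
    simp
    ring
  rw [mem_idealOn_mul Y hg hl (mul_comm l g) one_pos hx] at h2
  convert h2 using 4
  simp [frac, Away.isLocalizationElem]

lemma linear_eq_sum {l : CoordRing K} (hl : l ∈ grading K 1) :
    ∃ c : Fin 3 → K, l = ∑ i, c i • MvPolynomial.X i := by
  have : l ∈ MvPolynomial.homogeneousSubmodule (Fin 3) K 1 := hl
  rw [MvPolynomial.homogeneousSubmodule_one_eq_span_X, Submodule.mem_span_range_iff_exists_fun] at this
  obtain ⟨c, hc⟩ := this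
  exact ⟨c, hc.symm⟩

/-- The homomorphism that sends a form `F` of degree `n` to `F / lⁿ`. -/
def dehom {l : CoordRing K} (hl : l ∈ grading K 1) : CoordRing K →+* Away (grading K) l :=
  MvPolynomial.eval₂Hom (awayConst l) (fun i => frac hl (X_mem_grading i))

lemma val_awayConst (l : CoordRing K) (c : K) :
    (awayConst l c).val = algebraMap (CoordRing K) (Localization.Away l) (MvPolynomial.C c) := by
  rfl

lemma val_frac {l : CoordRing K} (hl : l ∈ grading K 1) {n : ℕ} {F : CoordRing K}
    (hF : F ∈ grading K n) : algebraMap _ (Localization.Away l) l ^ n * (frac hl hF).val =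
      algebraMap _ (Localization.Away l) F := by
  rw [frac, Away.val_mk, Localization.mk_eq_mk', ← map_pow]
  exact IsLocalization.mk'_spec' (Localization.Away l) F
    (⟨l ^ n, ⟨n, rfl⟩⟩ : Submonoid.powers l)

/-- Forms of degree n are sums of products of n linear forms, so induction reduces the claim to the
variables. -/
lemma pow_mul_val_dehom {l : CoordRing K} (hl : l ∈ grading K 1) {n : ℕ} {F : CoordRing K}
    (hF : F ∈ grading K n) : algebraMap _ (Localization.Away l) l ^ n * (dehom hl F).val =
      algebraMap _ (Localization.Away l) F := by
  have hF' : F ∈ MvPolynomial.homogeneousSubmodule (Fin 3) K 1 ^ n := by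
    rwa [MvPolynomial.homogeneousSubmodule_one_pow]
  induction hF' using Submodule.pow_induction_on_left' with
  | algebraMap r =>
    simp only [pow_zero, one_mul, dehom, MvPolynomial.algebraMap_eq, MvPolynomial.coe_eval₂Hom,
      MvPolynomial.eval₂_C]
    exact val_awayConst l r
  | add x y i hx hy ihx ihy =>
    rw [MvPolynomial.homogeneousSubmodule_one_pow] at hx hy
    rw [map_add, HomogeneousLocalization.val_add, mul_add, ihx hx, ihy hy, map_add]
  | mem_mul m hm i x hx ih =>
    rw [MvPolynomial.homogeneousSubmodule_one_pow] at hx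
    rw [map_mul, HomogeneousLocalization.val_mul, pow_succ', mul_mul_mul_comm, ih hx, map_mul]
    congr 1
    obtain ⟨c, rfl⟩ := linear_eq_sum (K := K) hm
    simp only [map_sum, ← HomogeneousLocalization.algebraMap_apply, Finset.mul_sum,
      MvPolynomial.smul_eq_C_mul, map_mul]
    refine Finset.sum_congr rfl fun j _ => ?_
    have h1 : dehom hl (MvPolynomial.C (c j)) = awayConst l (c j) := by simp [dehom]
    have h2 : dehom hl (MvPolynomial.X j) = frac hl (X_mem_grading j) := by simp [dehom]
    rw [h1, h2, HomogeneousLocalization.algebraMap_apply, HomogeneousLocalization.algebraMap_apply,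
      val_awayConst, mul_left_comm, ← val_frac hl (X_mem_grading j), pow_one]

theorem dehom_eq_frac {l : CoordRing K} (hl : l ∈ grading K 1) {n : ℕ} {F : CoordRing K}
    (hF : F ∈ grading K n) : dehom hl F = frac hl hF := by
  apply HomogeneousLocalization.val_injective
  have hu : IsUnit (algebraMap (CoordRing K) (Localization.Away l) l) :=
    IsLocalization.Away.algebraMap_isUnit l
  rw [← (hu.pow n).mul_right_inj, val_frac, pow_mul_val_dehom hl hF]

lemma dehom_self {l : CoordRing K} (hl : l ∈ grading K 1) : dehom hl l = 1 := by
  apply HomogeneousLocalization.val_injective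
  have hu : IsUnit (algebraMap (CoordRing K) (Localization.Away l) l) :=
    IsLocalization.Away.algebraMap_isUnit l
  have h := pow_mul_val_dehom hl hl
  rw [pow_one] at h
  rw [← hu.mul_right_inj, HomogeneousLocalization.val_one, mul_one, h]

lemma dehom_surjective {l : CoordRing K} (hl : l ∈ grading K 1) :
    Function.Surjective (dehom hl) := by
  intro a
  obtain ⟨n, F, hF, rfl⟩ := Away.mk_surjective (grading K) hl a
  rw [smul_eq_mul, mul_one] at hF
  exact ⟨F, dehom_eq_frac hl hF⟩

lemma dehom_C {l : CoordRing K} (hl : l ∈ grading K 1) (c : K) :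
    dehom hl (MvPolynomial.C c) = awayConst l c := by
  simp [dehom]

lemma mem_of_pow_mul_mem {R : Type*} [CommRing R] {s a : R} {I : Ideal R}
    (h : Ideal.span {s} ⊔ I = ⊤) {k : ℕ} (hk : s ^ k * a ∈ I) : a ∈ I := by
  induction k with
  | zero => simpa using hk
  | succ k ih =>
    apply ih
    obtain ⟨x, hx, y, hy, hxy⟩ := Submodule.mem_sup.mp ((Ideal.eq_top_iff_one _).mp h)
    obtain ⟨c, rfl⟩ := Ideal.mem_span_singleton'.mp hx
    have : s ^ k * a = c * (s ^ (k + 1) * a) + s ^ k * a * y := by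
      linear_combination (-s ^ k * a) * hxy
    rw [this]
    exact add_mem (Ideal.mul_mem_left _ _ hk) (Ideal.mul_mem_left _ _ hy)

/-- The three charts may be replaced by D₊(l). Going to a chart, the lost power of l/xᵢ cancels,
being a unit modulo the ideal. Coming back, powers of the xᵢ/l are lost, but these functions
generate the unit ideal because `l` is a combination of the xᵢ. -/
theorem mem_idealOn_iff (Y : ClosedSubscheme K) {l : CoordRing K} (hl : l ∈ grading K 1)
    (hY : ∀ y : Y.subscheme, Y.subschemeι y ∈ Proj.basicOpen (grading K) l)
    {n : ℕ} {F : CoordRing K} (hF : F ∈ grading K n) :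
    frac hl hF ∈ Y.idealOn hl one_pos ↔ ∀ i, dehomogenize i F hF ∈ Y.chartIdeal i := by
  constructor
  · intro h i
    obtain ⟨k, hk⟩ := frac_mem_of_frac_mem Y hl (X_mem_grading i) hF h
    have h1 := idealOn_sup_span_eq_top Y hl one_pos hY (X_mem_grading i) one_pos
    have h2 : Ideal.span {frac (X_mem_grading i) hl} ⊔ Y.idealOn (X_mem_grading i) one_pos = ⊤ := by
      convert h1 using 4
      simp [frac, Away.isLocalizationElem]
    exact mem_of_pow_mul_mem h2 hk
  · intro h
    have h1 : ∀ i, ∃ k, frac hl (X_mem_grading i) ^ k * frac hl hF ∈ Y.idealOn hl one_pos :=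
      fun i => frac_mem_of_frac_mem Y (X_mem_grading i) hl hF (h i)
    choose k hk using h1
    by_contra hne
    let c : Ideal (Away (grading K) l) := (Y.idealOn hl one_pos).colon {frac hl hF}
    have hc : c ≠ ⊤ := by
      intro hc
      have : (1 : Away (grading K) l) ∈ c := hc ▸ Submodule.mem_top
      rw [Submodule.mem_colon_singleton] at this
      exact hne (by simpa using this)
    obtain ⟨p, hp, hle⟩ := Ideal.exists_le_maximal _ hc
    have h2 : ∀ i, frac hl (X_mem_grading i) ∈ p := fun i =>
      hp.isPrime.mem_of_pow_mem (k i) (hle (Submodule.mem_colon_singleton.mpr (hk i)))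
    obtain ⟨a, ha⟩ := linear_eq_sum hl
    have h3 : ∑ i, awayConst l (a i) * frac hl (X_mem_grading i) = 1 := by
      refine Eq.trans ?_ ((congrArg (dehom hl) ha).symm.trans (dehom_self hl))
      simp only [map_sum, MvPolynomial.smul_eq_C_mul, map_mul, dehom_C,
        dehom_eq_frac hl (X_mem_grading _)]
    exact hp.ne_top ((Ideal.eq_top_iff_one _).mpr (h3 ▸ Ideal.sum_mem _ fun i _ => Ideal.mul_mem_left _ _ (h2 i)))
end Plane

end

/-! ### Evaluation of forms, general linear forms, and lines -/

noncomputable section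
namespace Plane
variable {K : Type u} [Field K]
open HomogeneousLocalization

/-- The evaluation of the coordinate ring on a subscheme of `D₊(l)`, for which `l` is `1`. -/
def evalOn (Y : ClosedSubscheme K) {l : CoordRing K} (hl : l ∈ grading K 1)
    (hY : ⊤ = Y.subschemeι ⁻¹ᵁ Proj.basicOpen (grading K) l) : CoordRing K →+* Γ(Y.subscheme, ⊤) :=
  (Proj.awayToSection (grading K) l ≫ Y.subschemeι.appLE _ ⊤ hY.le).hom.comp (dehom hl)

lemma evalOn_surjective (Y : ClosedSubscheme K) {l : CoordRing K} (hl : l ∈ grading K 1)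
    (hY : ⊤ = Y.subschemeι ⁻¹ᵁ Proj.basicOpen (grading K) l) :
    Function.Surjective (evalOn Y hl hY) := by
  have h := (subscheme_appLE Y (opens hl one_pos) ⊤ hY).1
  exact (h.comp (awayToSection_bijective hl one_pos).surjective).comp (dehom_surjective hl)

lemma evalOn_eq_zero_iff (Y : ClosedSubscheme K) {l : CoordRing K} (hl : l ∈ grading K 1)
    (hY : ⊤ = Y.subschemeι ⁻¹ᵁ Proj.basicOpen (grading K) l) (f : CoordRing K) :
    evalOn Y hl hY f = 0 ↔ dehom hl f ∈ Y.idealOn hl one_pos := by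
  have h := (subscheme_appLE Y (opens hl one_pos) ⊤ hY).2
  rw [ClosedSubscheme.idealOn, Ideal.mem_comap, ← h, RingHom.mem_ker]
  rfl

lemma evalOn_C (Y : ClosedSubscheme K) {l : CoordRing K} (hl : l ∈ grading K 1)
    (hY : ⊤ = Y.subschemeι ⁻¹ᵁ Proj.basicOpen (grading K) l) (c : K) :
    evalOn Y hl hY (MvPolynomial.C c) = Y.scalars c := by
  have h := awayToSection_const hl one_pos
  have h2 : Y.scalars = (CommRingCat.ofHom (awayConst l) ≫ Proj.awayToSection (grading K) l ≫
      Y.subschemeι.appLE _ ⊤ hY.le).hom := by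
    rw [← Category.assoc, ← h, ClosedSubscheme.scalars, ClosedSubscheme.structureMap,
      Scheme.Hom.comp_appTop]
    simp only [Category.assoc, Scheme.Hom.map_appLE]
    congr 3
    exact Scheme.Hom.app_eq_appLE _
  rw [h2, evalOn, RingHom.comp_apply, dehom_C]
  rfl

lemma finite_scalars {X : ClosedSubscheme K} (hX : X.IsFiniteScheme) : X.scalars.Finite := by
  have : IsFinite X.structureMap := hX
  have h := X.structureMap.finite_appTop
  refine RingHom.Finite.comp h ?_
  exact RingHom.Finite.of_surjective _
    (Scheme.ΓSpecIso (CommRingCat.of K)).symm.commRingCatIsoToRingEquiv.surjective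

lemma finite_points {X : ClosedSubscheme K} (hX : X.IsFiniteScheme) : Finite X.subscheme := by
  have : IsFinite X.structureMap := hX
  have : IsAffine X.subscheme := isAffine_of_isAffineHom X.structureMap
  let := X.scalars.toAlgebra
  have : Module.Finite K Γ(X.subscheme, ⊤) := finite_scalars hX
  have : IsArtinianRing Γ(X.subscheme, ⊤) := IsArtinianRing.of_finite K _
  have : Finite (PrimeSpectrum Γ(X.subscheme, ⊤)) := inferInstance
  exact Finite.of_equiv _ X.subscheme.isoSpec.schemeIsoToHomeo.symm.toEquiv

variable (K) in
lemma irrelevant_le_span_X : (HomogeneousIdeal.irrelevant (grading K)).toIdeal ≤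
    Ideal.span (Set.range (MvPolynomial.X : Fin 3 → CoordRing K)) := by
  intro a ha
  have h : (MvPolynomial.homogeneousComponent 0) a = 0 :=
    (MvPolynomial.decomposition.decompose'_apply a 0).symm.trans
      ((HomogeneousIdeal.mem_irrelevant_iff _ _).mp ha)
  rw [MvPolynomial.homogeneousComponent_zero, MvPolynomial.C_eq_zero] at h
  rw [← Set.image_univ, MvPolynomial.mem_ideal_span_X_image]
  intro m hm
  by_contra! hc
  have : m = 0 := by ext i; simpa using hc i
  exact (MvPolynomial.mem_support_iff.mp hm) (this ▸ h)

variable (K) in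
lemma iSup_chart : ⨆ i, (chart (K := K) i).1 = ⊤ :=
  Proj.iSup_basicOpen_eq_top _ _ (irrelevant_le_span_X K)

lemma exists_linear_form [Infinite K] {X : ClosedSubscheme K} (hX : X.IsFiniteScheme) :
    ∃ l ∈ grading K 1, l ≠ 0 ∧
      ∀ y : X.subscheme, X.subschemeι y ∈ Proj.basicOpen (grading K) l := by
  have := finite_points hX
  -- A vector space over an infinite field is not a finite union of proper subspaces. The index
  -- `none` carries the zero subspace, so that `l` is nonzero even if `X` is empty.
  let W : Option X.subscheme → Submodule K (grading K 1) := fun y =>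
    y.elim ⊥ (fun y => 
    ((X.subschemeι y).asHomogeneousIdeal.toIdeal.restrictScalars K).comap (grading K 1).subtype)
  have hW : ∀ y, W y ≠ ⊤ := by
    intro y h
    cases y with
    | none =>
      have : (⟨_, X_mem_grading 0⟩ : grading K 1) ∈ W none := h ▸ Submodule.mem_top
      have : (⟨_, X_mem_grading 0⟩ : grading K 1) = 0 := this
      exact MvPolynomial.X_ne_zero 0 (Subtype.ext_iff.mp this)
    | some y =>
      have h1 : ∀ i, (MvPolynomial.X i : CoordRing K) ∈ (X.subschemeι y).asHomogeneousIdeal := by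
        intro i
        have : (⟨_, X_mem_grading i⟩ : grading K 1) ∈ W (some y) := h ▸ Submodule.mem_top
        exact this
      apply (X.subschemeι y).not_irrelevant_le
      refine (irrelevant_le_span_X K).trans (Ideal.span_le.mpr ?_)
      rintro _ ⟨i, rfl⟩
      exact h1 i
  by_contra hcon
  push Not at hcon
  obtain ⟨y, hy⟩ := Subspace.exists_eq_top_of_iUnion_eq_univ (p := W) (by
    rw [Set.eq_univ_iff_forall]
    intro l
    rw [Set.mem_iUnion]
    by_cases hl0 : l.1 = 0
    · exact ⟨none, Subtype.ext hl0⟩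
    obtain ⟨y, hy⟩ := hcon l.1 l.2 hl0
    rw [Proj.mem_basicOpen, not_not] at hy
    exact ⟨some y, hy⟩)
  exact hW y hy

/-- The closed set of zeros of `m`. -/
def zeros (m : CoordRing K) : TopologicalSpace.Closeds (P2 K) :=
  (Proj.basicOpen (grading K) m).compl

/-- The reduced closed subscheme on the zeros of `m`. -/
def line (m : CoordRing K) : ClosedSubscheme K := Scheme.IdealSheafData.vanishingIdeal (zeros m)

/-- Defining the line by a vanishing ideal avoids gluing chart ideals; the price is a radical, which
`line_idealOn` removes. -/
lemma line_idealOn_eq_radical {l m : CoordRing K} (hl : l ∈ grading K 1) (hm : m ∈ grading K 1) :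
    (line m).idealOn hl one_pos = (Ideal.span {frac hl hm}).radical := by
  have hb := awayToSection_bijective hl one_pos
  let e := RingEquiv.ofBijective _ hb
  have hfrac : Away.isLocalizationElem hl hm = frac hl hm := by
    simp [frac, Away.isLocalizationElem]
  have key : ∀ q : Spec Γ(P2 K, Proj.basicOpen (grading K) l),
      (opens hl one_pos).2.fromSpec q ∈ zeros m ↔ e (frac hl hm) ∈ q.asIdeal := by
    intro q
    have h1 : (opens hl one_pos).2.fromSpec q ∈ zeros m ↔
      ¬ (Spec.map (Proj.awayToSection (grading K) l) q ∈
        Proj.awayι (grading K) l hl one_pos ⁻¹ᵁ Proj.basicOpen (grading K) m) := by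
      have := fromSpec_apply hl one_pos q
      change ¬ (_ ∈ Proj.basicOpen (grading K) m) ↔ ¬ (_ ∈ Proj.basicOpen (grading K) m)
      rw [not_iff_not]
      exact Eq.to_iff (congrArg (fun z => z ∈ Proj.basicOpen (grading K) m) this)
    rw [h1, Proj.awayι_preimage_basicOpen (grading K) hl one_pos hm one_pos, hfrac]
    exact not_not
  ext a
  have h2 : a ∈ (line m).idealOn hl one_pos ↔ ∀ q : Spec Γ(P2 K, Proj.basicOpen (grading K) l),
      (opens hl one_pos).2.fromSpec q ∈ zeros m → e a ∈ q.asIdeal := by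
    exact PrimeSpectrum.mem_vanishingIdeal _ _
  rw [h2]
  simp only [key]
  rw [Ideal.radical_eq_sInf, Submodule.mem_sInf]
  constructor
  · rintro h p ⟨hp, hpp⟩
    have := h (PrimeSpectrum.comap (e.symm : _ →+* _) ⟨p, hpp⟩) (by
      change e.symm (e _) ∈ p
      rw [e.symm_apply_apply]
      exact hp (Ideal.mem_span_singleton_self _))
    change e.symm (e _) ∈ p at this
    rwa [e.symm_apply_apply] at this
  · intro h q hq
    have := PrimeSpectrum.isPrime q
    exact h (q.asIdeal.comap (e : _ →+* _)) ⟨by rwa [Ideal.span_singleton_le_iff_mem], 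
      Ideal.comap_isPrime _ _⟩


lemma prime_of_mem_grading_one {m : CoordRing K} (hm : m ∈ grading K 1) (h0 : m ≠ 0) :
    Prime m := by
  refine (MvPolynomial.irreducible_of_totalDegree_eq_one
    (MvPolynomial.IsHomogeneous.totalDegree hm h0) fun x hx => ?_).prime
  obtain ⟨d, hd⟩ := MvPolynomial.ne_zero_iff.mp h0
  exact (ne_zero_of_dvd_ne_zero hd (hx d)).isUnit

lemma eq_zero_of_dehom_eq_zero {l : CoordRing K} (hl : l ∈ grading K 1) (h0 : l ≠ 0) {n : ℕ}
    {F : CoordRing K} (hF : F ∈ grading K n) (h : dehom hl F = 0) : F = 0 := by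
  have h1 := pow_mul_val_dehom hl hF
  rw [h, HomogeneousLocalization.val_zero, mul_zero] at h1
  exact (IsLocalization.injective (Localization.Away l)
    (powers_le_nonZeroDivisors_of_noZeroDivisors h0)) (by rw [← h1, map_zero])

/-- The principal ideal is already radical because a nonzero linear form is prime. If `m` divides
`l`, then m/l is a unit and the ideal is everything. -/
theorem line_idealOn {l m : CoordRing K} (hl : l ∈ grading K 1) (hm : m ∈ grading K 1)
    (hl0 : l ≠ 0) (hm0 : m ≠ 0) :
    (line m).idealOn hl one_pos = Ideal.span {frac hl hm} := by
  rw [line_idealOn_eq_radical hl hm]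
  refine le_antisymm ?_ Ideal.le_radical
  rintro a ⟨k, hk⟩
  have hp := prime_of_mem_grading_one hm hm0
  rw [Ideal.mem_span_singleton, ← dehom_eq_frac hl hm] at hk ⊢
  obtain ⟨b, hb⟩ := hk
  obtain ⟨n, F, hF, rfl⟩ := Away.mk_surjective (grading K) hl a
  obtain ⟨j, G, hG, rfl⟩ := Away.mk_surjective (grading K) hl b
  rw [smul_eq_mul, mul_one] at hF hG
  have hFf : Away.mk (grading K) hl n F (by simpa using hF) = dehom hl F :=
    (dehom_eq_frac hl hF).symm
  have hGf : Away.mk (grading K) hl j G (by simpa using hG) = dehom hl G :=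
    (dehom_eq_frac hl hG).symm
  rw [hFf, hGf] at hb
  rw [hFf]
  -- Denominators are cleared in (F/l^n)^k = (m/l)(G/l^j), giving an identity of forms to which
  -- primality of `m` applies.
  have h1 : l ^ (1 + j) * F ^ k - l ^ (k * n) * (m * G) ∈ grading K (k * n + (1 + j)) := by
    refine sub_mem ?_ (SetLike.mul_mem_graded ?_ (SetLike.mul_mem_graded hm hG))
    · rw [add_comm]
      refine SetLike.mul_mem_graded ?_ (SetLike.pow_mem_graded k hF)
      simpa using SetLike.pow_mem_graded (1 + j) hl
    · simpa using SetLike.pow_mem_graded (k * n) hl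
  have h2 := eq_zero_of_dehom_eq_zero hl hl0 h1 (by
    simp only [map_sub, map_mul, map_pow, dehom_self hl, hb]
    simp)
  have h3 : m ∣ l ^ (1 + j) * F ^ k := by
    rw [sub_eq_zero.mp h2]
    exact (Dvd.intro _ rfl).mul_left _
  rcases hp.dvd_or_dvd h3 with h4 | h4
  · obtain ⟨c, hc⟩ := hp.dvd_of_dvd_pow h4
    have h5 : dehom hl m * dehom hl c = 1 := by rw [← map_mul, ← hc, dehom_self]
    exact (IsUnit.of_mul_eq_one _ h5).dvd
  · exact map_dvd _ (hp.dvd_of_dvd_pow h4)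

theorem line_isLine {m : CoordRing K} (hm : m ∈ grading K 1) (hm0 : m ≠ 0) : (line m).IsLine :=
  ⟨m, hm, hm0, fun i => line_idealOn (X_mem_grading i) hm (MvPolynomial.X_ne_zero i) hm0⟩

theorem liesOn_line {X : ClosedSubscheme K} {m : CoordRing K} (hm : m ∈ grading K 1) (hm0 : m ≠ 0)
    (h : ∀ i, dehomogenize i m hm ∈ X.chartIdeal i) : X.LiesOn (line m) := by
  have : line m ≤ X := by
    refine Scheme.IdealSheafData.le_of_iSup_eq_top chart (iSup_chart K) fun i => ?_
    have hb := awayToSection_bijective (X_mem_grading (K := K) i) one_pos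
    rw [← Ideal.comap_le_comap_iff_of_surjective _ hb.surjective]
    change (line m).idealOn (X_mem_grading i) one_pos ≤ X.chartIdeal i
    rw [line_idealOn (X_mem_grading i) hm (MvPolynomial.X_ne_zero i) hm0,
      Ideal.span_singleton_le_iff_mem]
    exact h i
  exact this

lemma inter_range {M X : ClosedSubscheme K} {U : (P2 K).Opens}
    (h : ∀ y : X.subscheme, X.subschemeι y ∈ U) (y : (M.inter X).subscheme) :
    (M.inter X).subschemeι y ∈ U := by
  have hle : X ≤ M.inter X := le_sup_right (a := (M : (P2 K).IdealSheafData)) (b := X)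
  have := Scheme.IdealSheafData.inclusion_subschemeι hle
  rw [← this, Scheme.Hom.comp_apply]
  exact h _

lemma inter_idealOn (M X : ClosedSubscheme K) {l : CoordRing K} (hl : l ∈ grading K 1) :
    (M.inter X).idealOn hl one_pos = M.idealOn hl one_pos ⊔ X.idealOn hl one_pos := by
  have hb := awayToSection_bijective hl one_pos
  have h := fun Y : ClosedSubscheme K => Ideal.map_comap_of_surjective
    (Proj.awayToSection (grading K) l).hom hb.surjective (Y.ideal (opens hl one_pos))
  change Ideal.comap _ (M.ideal (opens hl one_pos) ⊔ X.ideal (opens hl one_pos)) = _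
  rw [← h M, ← h X, ← Ideal.map_sup, Ideal.comap_map_of_bijective _ hb]
  rfl

lemma top_eq_preimage {Y : ClosedSubscheme K} {U : (P2 K).Opens}
    (h : ∀ y : Y.subscheme, Y.subschemeι y ∈ U) : ⊤ = Y.subschemeι ⁻¹ᵁ U :=
  (eq_top_iff.mpr fun y _ => h y).symm

/-- Ideals add on D₊(l), so the functions on the intersection are those on `X` modulo the value of
`m`. -/
theorem evalOn_inter_line_eq_zero_iff {X : ClosedSubscheme K} {l m : CoordRing K}
    (hl : l ∈ grading K 1) (hm : m ∈ grading K 1) (hl0 : l ≠ 0) (hm0 : m ≠ 0)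
    (hX : ⊤ = X.subschemeι ⁻¹ᵁ Proj.basicOpen (grading K) l)
    (hMX : ⊤ = ((line m).inter X).subschemeι ⁻¹ᵁ Proj.basicOpen (grading K) l)
    (f : CoordRing K) :
    evalOn ((line m).inter X) hl hMX f = 0 ↔ evalOn X hl hX m ∣ evalOn X hl hX f := by
  rw [evalOn_eq_zero_iff, inter_idealOn, line_idealOn hl hm hl0 hm0, ← dehom_eq_frac hl hm]
  constructor
  · intro h
    obtain ⟨a, ha, b, hb, hab⟩ := Submodule.mem_sup.mp h
    obtain ⟨c, rfl⟩ := Ideal.mem_span_singleton'.mp ha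
    obtain ⟨c, rfl⟩ := dehom_surjective hl c
    refine ⟨evalOn X hl hX c, ?_⟩
    rw [← map_mul, ← sub_eq_zero, ← map_sub, evalOn_eq_zero_iff, map_sub, ← hab, map_mul]
    convert hb using 1
    ring
  · rintro ⟨c, hc⟩
    obtain ⟨c, rfl⟩ := evalOn_surjective X hl hX c
    rw [← map_mul, ← sub_eq_zero, ← map_sub, evalOn_eq_zero_iff, map_sub, map_mul] at hc
    refine Submodule.mem_sup.mpr ⟨dehom hl c * dehom hl m,
      Ideal.mem_span_singleton'.mpr ⟨_, rfl⟩, _, hc, by ring⟩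

theorem homogeneousIdeal_eq_span {X : ClosedSubscheme K} {l : CoordRing K}
    (hl : l ∈ grading K 1) (h : ∀ y : X.subscheme, X.subschemeι y ∈ Proj.basicOpen (grading K) l) :
    X.homogeneousIdeal =
      Ideal.span {f | ∃ n, f ∈ grading K n ∧ evalOn X hl (top_eq_preimage h) f = 0} := by
  rw [ClosedSubscheme.homogeneousIdeal]
  congr 1
  ext f
  refine exists_congr fun n => ?_
  constructor
  · rintro ⟨hf, h1⟩
    exact ⟨hf, by rw [evalOn_eq_zero_iff, dehom_eq_frac hl hf, mem_idealOn_iff X hl h]; exact h1⟩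
  · rintro ⟨hf, h1⟩
    exact ⟨hf, by rwa [evalOn_eq_zero_iff, dehom_eq_frac hl hf, mem_idealOn_iff X hl h] at h1⟩
end Plane

end

/-! ### The Koszul complex on three variables -/

noncomputable section
namespace Plane
open MvPolynomial
variable {K : Type u} [Field K]

lemma mem_idealOfVars_smul_iff {M : Type*} [AddCommGroup M] [Module (CoordRing K) M]
    {N : Submodule (CoordRing K) M} {v : M} :
    v ∈ idealOfVars (Fin 3) K • N ↔
      ∃ n : Fin 3 → M, (∀ i, n i ∈ N) ∧ v = ∑ i, (X i : CoordRing K) • n i := by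
  constructor
  · intro h
    induction h using Submodule.smul_induction_on' with
    | smul r hr n hn =>
      obtain ⟨c, rfl⟩ := Ideal.mem_span_range_iff_exists_fun.mp hr
      refine ⟨fun i => c i • n, fun i => N.smul_mem _ hn, ?_⟩
      rw [Finset.sum_smul]
      exact Finset.sum_congr rfl fun i _ => by rw [smul_smul, mul_comm]
    | add x _ y _ hx hy =>
      obtain ⟨a, ha, rfl⟩ := hx
      obtain ⟨b, hb, rfl⟩ := hy
      exact ⟨a + b, fun i => N.add_mem (ha i) (hb i), by simp [Finset.sum_add_distrib]⟩
  · rintro ⟨n, hn, rfl⟩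
    exact Submodule.sum_mem _ fun i _ =>
      Submodule.smul_mem_smul (Ideal.subset_span ⟨i, rfl⟩) (hn i)

lemma exists_eq_of_mem_pow {k : ℕ} {f : CoordRing K} (hf : f ∈ idealOfVars (Fin 3) K ^ (k + 1)) :
    ∃ a : Fin 3 → CoordRing K, (∀ i, a i ∈ idealOfVars (Fin 3) K ^ k) ∧
      f = X 0 * a 0 + X 1 * a 1 + X 2 * a 2 := by
  rw [pow_succ', ← smul_eq_mul, mem_idealOfVars_smul_iff] at hf
  simpa [Fin.sum_univ_three] using hf

lemma mem_pow_of_X_mul_mem {k : ℕ} {i : Fin 3} {f : CoordRing K}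
    (hf : X i * f ∈ idealOfVars (Fin 3) K ^ k) : f ∈ idealOfVars (Fin 3) K ^ (k - 1) := by
  rw [mem_pow_idealOfVars_iff'] at hf ⊢
  intro x hx
  have := hf (x + Finsupp.single i 1) (by simp; lia)
  rwa [mul_comm, coeff_mul_X] at this

/-- Splitting off the terms that are divisible by a variable. -/
lemma exists_split {k : ℕ} (f : CoordRing K) (hf : f ∈ idealOfVars (Fin 3) K ^ k) :
    ∃ f₀ f₁ : CoordRing K, f = f₀ + X 2 * f₁ ∧ (∀ x, x 2 ≠ 0 → coeff x f₀ = 0) ∧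
      f₀ ∈ idealOfVars (Fin 3) K ^ k ∧ f₁ ∈ idealOfVars (Fin 3) K ^ (k - 1) := by
  have h1 := divMonomial_add_modMonomial_single f 2
  have h2 : ∀ x, x 2 ≠ 0 → coeff x (f.modMonomial (Finsupp.single 2 1)) = 0 := by
    intro x hx
    exact coeff_modMonomial_of_le _ (by simpa [Nat.one_le_iff_ne_zero] using hx)
  have h3 : f.modMonomial (Finsupp.single 2 1) ∈ idealOfVars (Fin 3) K ^ k := by
    rw [mem_pow_idealOfVars_iff'] at hf ⊢
    intro x hx
    by_cases h : x 2 = 0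
    · rw [coeff_modMonomial_of_not_le _ (by simpa using h)]
      exact hf x hx
    · exact h2 x h
  refine ⟨_, _, (by rw [add_comm]; exact h1.symm), h2, h3, mem_pow_of_X_mul_mem (i := 2) ?_⟩
  rw [eq_sub_of_add_eq h1]
  exact sub_mem hf h3

lemma koszul_two {p q s : CoordRing K} (h2 : X 0 * p = X 2 * s)
    (h3 : X 0 * q = - (X 1 * s)) : ∃ w, p = X 2 * w ∧ q = - (X 1 * w) ∧ s = X 0 * w := by
  have hx : ∀ i : Fin 3, (X i : CoordRing K) ≠ 0 := fun i => X_ne_zero i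
  have hd : (X 0 : CoordRing K) ∣ X 2 * s := ⟨p, h2.symm⟩
  rcases (X_prime (i := (0 : Fin 3))).dvd_or_dvd hd with h | ⟨w, rfl⟩
  · simp at h
  refine ⟨w, mul_left_cancel₀ (hx 0) (by rw [h2]; ring), mul_left_cancel₀ (hx 0) (by rw [h3]; ring),
    rfl⟩

/-- Koszul exactness with the loss of one order recorded. The terms free of x₂ satisfy x₀f₀ + x₁g₀ =
0, which yields `p`; the multiples of x₂ in `f` and `g` yield `q` and `s`. -/
lemma koszul_one {k : ℕ} {f g h : CoordRing K} (hf : f ∈ idealOfVars (Fin 3) K ^ k)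
    (hg : g ∈ idealOfVars (Fin 3) K ^ k) (h0 : X 0 * f + X 1 * g + X 2 * h = 0) :
    ∃ p ∈ idealOfVars (Fin 3) K ^ (k - 1), ∃ q ∈ idealOfVars (Fin 3) K ^ (k - 1),
      ∃ s ∈ idealOfVars (Fin 3) K ^ (k - 1),
      f = X 1 * p + X 2 * q ∧ g = - (X 0 * p) + X 2 * s ∧ h = - (X 0 * q) - X 1 * s := by
  have hx : ∀ i : Fin 3, (X i : CoordRing K) ≠ 0 := fun i => X_ne_zero i
  obtain ⟨f₀, f₁, rfl, hf2, hf₀, hf₁⟩ := exists_split f hf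
  obtain ⟨g₀, g₁, rfl, hg2, hg₀, hg₁⟩ := exists_split g hg
  have h1 : X 0 * f₀ + X 1 * g₀ = 0 := by
    have hd : (X 2 : CoordRing K) ∣ X 0 * f₀ + X 1 * g₀ :=
      ⟨- (X 0 * f₁ + X 1 * g₁ + h), by linear_combination h0⟩
    obtain ⟨c, hc⟩ := hd
    ext x
    by_cases h2 : x 2 = 0
    · rw [hc, coeff_X_mul']
      simp [h2]
    · rw [coeff_add, coeff_X_mul', coeff_X_mul', hf2, hg2]
      · simp
      all_goals simpa using h2
  have hd : (X 1 : CoordRing K) ∣ X 0 * f₀ := ⟨- g₀, by linear_combination h1⟩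
  rcases (X_prime (i := (1 : Fin 3))).dvd_or_dvd hd with h | ⟨p, rfl⟩
  · simp at h
  have h2 : g₀ = - (X 0 * p) := mul_left_cancel₀ (hx 1) (by linear_combination h1)
  refine ⟨p, mem_pow_of_X_mul_mem hf₀, f₁, hf₁, g₁, hg₁, rfl, by rw [h2], ?_⟩
  refine mul_left_cancel₀ (hx 2) ?_
  linear_combination h0 - h1

/-- Subtracting the Koszul boundary of (p, q, s) from (a, b, c) moves the entries into the kernel
and leaves the combination unchanged, since consecutive Koszul maps compose to zero. -/
lemma mem_smul_ker {M N : Type*} [AddCommGroup M] [Module (CoordRing K) M] [AddCommGroup N]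
    [Module (CoordRing K) N] (φ : M →ₗ[CoordRing K] N) {a b c p q s : M}
    (ha : φ a = (X 1 : CoordRing K) • φ p + (X 2 : CoordRing K) • φ q)
    (hb : φ b = - ((X 0 : CoordRing K) • φ p) + (X 2 : CoordRing K) • φ s)
    (hc : φ c = - ((X 0 : CoordRing K) • φ q) - (X 1 : CoordRing K) • φ s) :
    (X 0 : CoordRing K) • a + (X 1 : CoordRing K) • b + (X 2 : CoordRing K) • c ∈
      idealOfVars (Fin 3) K • LinearMap.ker φ := by
  rw [mem_idealOfVars_smul_iff]
  refine ⟨![a - (X 1 : CoordRing K) • p - (X 2 : CoordRing K) • q,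
    b + (X 0 : CoordRing K) • p - (X 2 : CoordRing K) • s,
    c + (X 0 : CoordRing K) • q + (X 1 : CoordRing K) • s], ?_, ?_⟩
  · intro i
    fin_cases i
    · simp [ha]
    · simp [hb]
    · simp [hc, sub_add_eq_add_sub]
  · simp only [Fin.sum_univ_three, Matrix.cons_val_zero, Matrix.cons_val_one, Matrix.cons_val]
    module

/-- Linear forms act as zero on Koszul homology with coefficients in S/I. The witness is the
contraction of (p, q, s) with `c`. -/
lemma C_mul_sum_mem {I : Ideal (CoordRing K)} {c : Fin 3 → K} {p q s : CoordRing K}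
    (h1 : X 1 * p + X 2 * q ∈ I) (h2 : - (X 0 * p) + X 2 * s ∈ I)
    (h3 : - (X 0 * q) - X 1 * s ∈ I) :
    ∃ w, (∑ i, c i • X i) * p - X 2 * w ∈ I ∧ (∑ i, c i • X i) * q + X 1 * w ∈ I ∧
      (∑ i, c i • X i) * s - X 0 * w ∈ I := by
  simp only [Fin.sum_univ_three, smul_eq_C_mul]
  refine ⟨C (c 0) * s - C (c 1) * q + C (c 2) * p, ?_, ?_, ?_⟩
  · convert sub_mem (I.mul_mem_left (C (c 1)) h1) (I.mul_mem_left (C (c 0)) h2) using 1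
    ring
  · convert sub_mem (I.mul_mem_left (C (c 2)) h1) (I.mul_mem_left (C (c 0)) h3) using 1
    ring
  · convert sub_mem (I.mul_mem_left (C (c 2)) h2) (I.mul_mem_left (C (c 1)) h3) using 1
    ring

/-- Bounds the degrees of generators. Write f = Σ xᵢaᵢ with aᵢ ≡ l bᵢ modulo `I`; cancelling `l`
gives Σ xᵢbᵢ ∈ I, and f = Σ xᵢ(aᵢ - l bᵢ) + l Σ xᵢbᵢ. -/
lemma mem_smul_of_mem_pow {I : Ideal (CoordRing K)} {r : ℕ} {l : CoordRing K}
    (hl : l ∈ idealOfVars (Fin 3) K) (hnz : ∀ f, l * f ∈ I → f ∈ I)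
    (hr : ∀ f ∈ idealOfVars (Fin 3) K ^ r, ∃ g, f - l * g ∈ I) {f : CoordRing K} (hf : f ∈ I)
    (hfr : f ∈ idealOfVars (Fin 3) K ^ (r + 1)) : f ∈ idealOfVars (Fin 3) K • I := by
  obtain ⟨a, ha, rfl⟩ := exists_eq_of_mem_pow hfr
  choose! b hb using hr
  have h1 : ∀ i, a i - l * b (a i) ∈ I := fun i => hb _ (ha i)
  have h2 : ∀ i, X i * (a i - l * b (a i)) ∈ idealOfVars (Fin 3) K • I := fun i =>
    Submodule.smul_mem_smul (Ideal.subset_span ⟨i, rfl⟩) (h1 i)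
  have h3 : X 0 * b (a 0) + X 1 * b (a 1) + X 2 * b (a 2) ∈ I := by
    apply hnz
    convert sub_mem hf (add_mem (add_mem (I.mul_mem_left (X 0) (h1 0))
      (I.mul_mem_left (X 1) (h1 1))) (I.mul_mem_left (X 2) (h1 2))) using 1
    ring
  convert add_mem (add_mem (add_mem (h2 0) (h2 1)) (h2 2)) (Submodule.smul_mem_smul hl h3) using 1
  simp only [smul_eq_mul]
  ring

end Plane

end

/-! ### Graded modules and minimal homogeneous generators -/

noncomputable section
namespace Plane
open MvPolynomial
variable {K : Type u} [Field K]

/-- The projections to the homogeneous components of a graded module over the coordinate ring. -/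
structure Components (M : Type*) [AddCommGroup M] [Module (CoordRing K) M] where
  proj : ℕ → M →+ M
  exists_sum : ∀ v, ∃ T : Finset ℕ, v = ∑ t ∈ T, proj t v
  proj_proj : ∀ s t v, proj s (proj t v) = if s = t then proj t v else 0
  proj_smul : ∀ (e t : ℕ) (f : CoordRing K) v, f.IsHomogeneous e →
    proj t (f • v) = if e ≤ t then f • proj (t - e) v else 0

namespace Components

variable {M : Type*} [AddCommGroup M] [Module (CoordRing K) M] (π : Components (K := K) M)

lemma proj_smul_of_homogeneous {e : ℕ} {v : M} (hv : π.proj e v = v) (t : ℕ) (w : CoordRing K) :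
    π.proj t (w • v) = if e ≤ t then homogeneousComponent (t - e) w • v else 0 := by
  conv_lhs => rw [← sum_homogeneousComponent w]
  rw [Finset.sum_smul, map_sum]
  have h : ∀ i, π.proj t (homogeneousComponent i w • v) =
      if i + e = t then homogeneousComponent (t - e) w • v else 0 := by
    intro i
    rw [π.proj_smul i t _ _ (homogeneousComponent_isHomogeneous i w)]
    have h1 : π.proj (t - i) v = if t - i = e then v else 0 := by
      conv_lhs => rw [← hv]
      rw [π.proj_proj, hv]
    rw [h1]
    split_ifs with h1 h2 h3 h4 h5
    · rw [← h3, Nat.add_sub_cancel]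
    · lia
    · lia
    · rw [smul_zero]
    · lia
    · rfl
  simp only [h]
  split_ifs with het
  · rw [Finset.sum_eq_single (t - e)]
    · simp [Nat.sub_add_cancel het]
    · intro b _ hb
      rw [if_neg (by lia)]
    · intro hb
      rw [homogeneousComponent_eq_zero _ _ (by have := hb; simp at this; lia), zero_smul, ite_self]
  · exact Finset.sum_eq_zero fun i _ => if_neg (by lia)

/-- A finite family of homogeneous generators of `N` of degrees `d`. -/
def Generates (N : Submodule (CoordRing K) M) {m : ℕ} (d : Fin m → ℕ) (s : Fin m → M) : Prop :=
  (∀ k, π.proj (d k) (s k) = s k) ∧ Submodule.span (CoordRing K) (Set.range s) = N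

lemma exists_generates {N : Submodule (CoordRing K) M} (hfg : N.FG)
    (hN : ∀ v ∈ N, ∀ t, π.proj t v ∈ N) :
    ∃ m, ∃ (d : Fin m → ℕ) (s : Fin m → M), π.Generates N d s := by
  obtain ⟨G, hG⟩ := hfg
  choose T hT using π.exists_sum
  let ι := Σ v : G, T v.1
  let e := Fintype.equivFin ι
  refine ⟨Fintype.card ι, fun k => (e.symm k).2.1, fun k => π.proj (e.symm k).2.1 (e.symm k).1.1,
    fun k => by simp [π.proj_proj], le_antisymm ?_ ?_⟩
  · rw [Submodule.span_le]
    rintro _ ⟨k, rfl⟩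
    exact hN _ (hG ▸ Submodule.subset_span (e.symm k).1.2) _
  · conv_lhs => rw [← hG]
    rw [Submodule.span_le]
    intro v hv
    rw [hT v]
    refine Submodule.sum_mem _ fun t ht => Submodule.subset_span ⟨e ⟨⟨v, hv⟩, ⟨t, ht⟩⟩, ?_⟩
    change π.proj (e.symm (e _)).2.1 (e.symm (e _)).1.1 = _
    rw [Equiv.symm_apply_apply]

/-- The component of the relation in degree `d j` has the constant term of `w j` as coefficient of
`s j`, hence can be solved for `s j`. -/
lemma generates_succAbove {N : Submodule (CoordRing K) M} {m : ℕ} {d : Fin (m + 1) → ℕ}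
    {s : Fin (m + 1) → M} (h : π.Generates N d s) {w : Fin (m + 1) → CoordRing K}
    (hw : ∑ k, w k • s k = 0) {j : Fin (m + 1)} (hj : constantCoeff (w j) ≠ 0) :
    π.Generates N (d ∘ j.succAbove) (s ∘ j.succAbove) := by
  refine ⟨fun k => h.1 _, ?_⟩
  rw [← h.2]
  refine le_antisymm (Submodule.span_mono (Set.range_comp_subset_range _ _)) ?_
  rw [Submodule.span_le]
  rintro _ ⟨k, rfl⟩
  rcases Fin.eq_self_or_eq_succAbove j k with rfl | ⟨i, rfl⟩
  · have h1 := congrArg (π.proj (d k)) hw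
    rw [map_sum, map_zero, Fin.sum_univ_succAbove _ k,
      π.proj_smul_of_homogeneous (h.1 k), if_pos le_rfl, Nat.sub_self,
      homogeneousComponent_zero] at h1
    have h2 : s k = - (C (constantCoeff (w k))⁻¹ : CoordRing K) •
        ∑ i : Fin m, π.proj (d k) (w (k.succAbove i) • s (k.succAbove i)) := by
      rw [← neg_eq_of_add_eq_zero_right h1, smul_neg, neg_smul, neg_neg, smul_smul, ← C_mul]
      change _ = C ((constantCoeff (w k))⁻¹ * constantCoeff (w k)) • _
      rw [inv_mul_cancel₀ hj, C_1, one_smul]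
    rw [h2]
    refine Submodule.smul_mem _ _ (Submodule.sum_mem _ fun i _ => ?_)
    rw [π.proj_smul_of_homogeneous (h.1 _)]
    split_ifs
    · exact Submodule.smul_mem _ _ (Submodule.subset_span ⟨i, rfl⟩)
    · exact Submodule.zero_mem _
  · exact Submodule.subset_span ⟨i, rfl⟩

/-- Minimal homogeneous generators. -/
theorem exists_minimal_generates {N : Submodule (CoordRing K) M} (hfg : N.FG)
    (hN : ∀ v ∈ N, ∀ t, π.proj t v ∈ N) {D : ℕ}
    (hD : ∀ v ∈ N, ∀ t > D, π.proj t v = v → v ∈ idealOfVars (Fin 3) K • N) :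
    ∃ m, ∃ (d : Fin m → ℕ) (s : Fin m → M), π.Generates N d s ∧ (∀ k, d k ≤ D) ∧
      ∀ w : Fin m → CoordRing K, ∑ k, w k • s k = 0 → ∀ k, constantCoeff (w k) = 0 := by
  classical
  -- The least possible number of generators excludes relations with a nonzero constant term.
  have hex := π.exists_generates hfg hN
  obtain ⟨d, s, h⟩ := Nat.find_spec hex
  have hmin := fun m => Nat.find_min (m := m) hex
  generalize Nat.find hex = m at d s h hmin
  have hrel : ∀ w : Fin m → CoordRing K, ∑ k, w k • s k = 0 → ∀ k, constantCoeff (w k) = 0 := by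
    intro w hw k
    by_contra hk
    cases m with
    | zero => exact k.elim0
    | succ m => exact hmin m (Nat.lt_succ_self m) ⟨_, _, π.generates_succAbove h hw hk⟩
  refine ⟨m, d, s, h, fun k => ?_, hrel⟩
  -- A generator of degree beyond `D` lies in 𝔪N; expanding it gives a relation whose `k`-th
  -- coefficient has constant term -1.
  by_contra! hk
  have h1 := hD (s k) (h.2 ▸ Submodule.subset_span ⟨k, rfl⟩) _ hk (h.1 k)
  rw [← h.2, Submodule.mem_ideal_smul_span_iff_exists_sum] at h1
  obtain ⟨a, ha, hs⟩ := h1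
  have h2 := hrel (fun i => a i - if i = k then 1 else 0) (by
    simp only [sub_smul, Finset.sum_sub_distrib, ite_smul, one_smul, zero_smul,
      Finset.sum_ite_eq', Finset.mem_univ, if_true]
    rw [← hs, Finsupp.sum_fintype _ _ (by simp), sub_self]) k
  have h3 : constantCoeff (a k) = 0 := by
    have := (mem_pow_idealOfVars_iff' 1 (a k)).mp (by rw [pow_one]; exact ha k) 0 (by simp)
    exact this
  simp [h3] at h2

end Components

lemma homogeneousComponent_mul_of_left {e : ℕ} {f : CoordRing K} (hf : f.IsHomogeneous e) (t : ℕ)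
    (g : CoordRing K) : homogeneousComponent t (f * g) =
      if e ≤ t then f * homogeneousComponent (t - e) g else 0 := by
  classical
  exact (decomposition.decompose'_apply (f * g) t).symm.trans
    ((DirectSum.coe_decompose_mul_of_left_mem (𝒜 := grading K) t hf).trans (by
      congr 1
      exact congrArg (f * ·) (decomposition.decompose'_apply g (t - e))))

/-- The homogeneous components of polynomials. -/
def polyComponents : Components (K := K) (CoordRing K) where
  proj t := (homogeneousComponent t).toAddMonoidHom
  exists_sum v := ⟨_, (sum_homogeneousComponent v).symm⟩
  proj_proj _ t v := homogeneousComponent_of_mem (homogeneousComponent_mem t v)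
  proj_smul _ t _ v hf := homogeneousComponent_mul_of_left hf t v

/-- The homogeneous components in the direct sum of the `S(-d j)`. -/
def shiftComponents {n : ℕ} (d : Fin n → ℕ) : Components (K := K) (Fin n → CoordRing K) where
  proj t :=
    { toFun := fun v j => if d j ≤ t then homogeneousComponent (t - d j) (v j) else 0
      map_zero' := by ext1 j; simp
      map_add' := fun v w => by ext1 j; simp only [Pi.add_apply, map_add]; split_ifs <;> simp }
  exists_sum v := by
    refine ⟨Finset.range (∑ j, (d j + (v j).totalDegree + 1)), ?_⟩
    ext1 j
    rw [Finset.sum_apply]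
    simp only [AddMonoidHom.coe_mk, ZeroHom.coe_mk]
    have h1 : d j + (v j).totalDegree + 1 ≤ ∑ j, (d j + (v j).totalDegree + 1) :=
      Finset.single_le_sum (f := fun j => d j + (v j).totalDegree + 1) (fun _ _ => Nat.zero_le _)
        (Finset.mem_univ j)
    obtain ⟨c, hc⟩ := Nat.exists_eq_add_of_le h1
    rw [hc, show d j + (v j).totalDegree + 1 + c = d j + ((v j).totalDegree + 1 + c) by ring,
      Finset.sum_range_add, Finset.sum_eq_zero, zero_add]
    · simp only [Nat.le_add_right, if_true, Nat.add_sub_cancel_left]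
      rw [Finset.sum_range_add, sum_homogeneousComponent, Finset.sum_eq_zero, add_zero]
      intro i _
      exact homogeneousComponent_eq_zero _ _ (by lia)
    · intro i hi
      rw [if_neg (by simpa using hi)]
  proj_proj s t v := by
    ext1 j
    simp only [AddMonoidHom.coe_mk, ZeroHom.coe_mk]
    by_cases hs : d j ≤ s <;> by_cases ht : d j ≤ t
    · simp only [hs, ht, if_true, homogeneousComponent_of_mem (homogeneousComponent_mem _ _)]
      by_cases h : s = t
      · simp [h, ht]
      · rw [if_neg (by lia), if_neg h]; rfl
    · by_cases h : s = t
      · exact absurd (h ▸ hs) ht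
      · simp [h, ht]
    · by_cases h : s = t
      · exact absurd (h ▸ ht) hs
      · simp [h, hs]
    · by_cases h : s = t
      · simp [h, ht]
      · simp [h, hs]
  proj_smul e t f v hf := by
    ext1 j
    simp only [AddMonoidHom.coe_mk, ZeroHom.coe_mk, Pi.smul_apply, smul_eq_mul,
      homogeneousComponent_mul_of_left hf]
    by_cases h1 : e ≤ t
    · simp only [h1, if_true, Pi.smul_apply, smul_eq_mul, mul_ite, mul_zero]
      by_cases h2 : d j ≤ t - e
      · rw [if_pos (by lia), if_pos (by lia), if_pos h2, Nat.sub_right_comm]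
      · rw [if_neg h2]
        split_ifs <;> first | rfl | lia
    · rw [if_neg h1]
      split_ifs <;> first | rfl | lia

lemma shiftComponents_proj {n : ℕ} (d : Fin n → ℕ) (t : ℕ) (v : Fin n → CoordRing K) (j : Fin n) :
    (shiftComponents d).proj t v j =
      if d j ≤ t then homogeneousComponent (t - d j) (v j) else 0 := rfl

end Plane

end

/-! ### The minimal resolution and the regularity criterion -/

noncomputable section
namespace Plane
open MvPolynomial
variable {K : Type u} [Field K]

/-- A resolution of length one. -/
def resolutionOfInjective {I : Ideal (CoordRing K)} {n m : ℕ} {d : Fin n → ℕ} {e : Fin m → ℕ}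
    {g : Fin n → CoordRing K} {s : Fin m → Fin n → CoordRing K}
    (hg : ∀ j, (g j).IsHomogeneous (d j))
    (hs : ∀ j k, s k j ≠ 0 → ∃ a, e k = d j + a ∧ (s k j).IsHomogeneous a)
    (hI : Ideal.span (Set.range g) = I)
    (hex : ∀ v : Fin n → CoordRing K, ∑ j, v j * g j = 0 ↔ ∃ w : Fin m → CoordRing K,
      ∑ k, w k • s k = v)
    (hinj : ∀ w : Fin m → CoordRing K, ∑ k, w k • s k = 0 → w = 0)
    (hmin : ∀ j k, constantCoeff (s k j) = 0) : MinimalGradedResolution I where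
  rank i := match i with
    | 0 => n
    | 1 => m
    | _ + 2 => 0
  deg i := match i with
    | 0 => d
    | 1 => e
    | _ + 2 => fun _ => 0
  gen := g
  diff i := match i with
    | 0 => Matrix.of fun j k => s k j
    | _ + 1 => 0
  gen_homogeneous := hg
  diff_homogeneous i := match i with
    | 0 => hs
    | _ + 1 => fun _ k => k.elim0
  span_gen := hI
  exact_zero v := by
    rw [hex]
    refine exists_congr fun w => ?_
    rw [show (Matrix.of fun j k => s k j).mulVec w = ∑ k, w k • s k from ?_]
    ext1 j
    simp [Matrix.mulVec, dotProduct, mul_comm]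
  exact_succ i := match i with
    | 0 => fun v => by
      have h : (Matrix.of fun j k => s k j).mulVec v = ∑ k, v k • s k := by
        ext1 j
        simp [Matrix.mulVec, dotProduct, mul_comm]
      constructor
      · intro hv
        exact ⟨0, by rw [Matrix.mulVec_zero, hinj v (h.symm.trans hv)]⟩
      · rintro ⟨w, rfl⟩
        exact Eq.trans (congrArg _ (Matrix.zero_mulVec w)) (Matrix.mulVec_zero _)
    | _ + 1 => fun v => ⟨fun _ => ⟨0, funext fun k => k.elim0⟩, fun _ => Matrix.zero_mulVec v⟩
  minimal i := match i with
    | 0 => hmin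
    | _ + 1 => fun _ k => k.elim0

/-- The Auslander–Buchsbaum phenomenon: S/I has depth at least one, so the second syzygies vanish.
Minimality and a Koszul chase give ker ψ ⊆ 𝔪 ker ψ, so entries of elements of ker ψ lie in every
power of 𝔪. -/
lemma linearCombination_ker_eq_bot {n m : ℕ} {I : Ideal (CoordRing K)} {c : Fin 3 → K}
    (hnz : ∀ f, (∑ i, c i • X i) * f ∈ I → f ∈ I)
    {g : Fin n → CoordRing K} {s : Fin m → Fin n → CoordRing K}
    (hI : LinearMap.range (Fintype.linearCombination (CoordRing K) g) = I)
    (hs : LinearMap.range (Fintype.linearCombination (CoordRing K) s) =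
      LinearMap.ker (Fintype.linearCombination (CoordRing K) g))
    (hmin : ∀ w ∈ LinearMap.ker (Fintype.linearCombination (CoordRing K) s), ∀ k,
      constantCoeff (w k) = 0) :
    LinearMap.ker (Fintype.linearCombination (CoordRing K) s) = ⊥ := by
  set φ := Fintype.linearCombination (CoordRing K) g with hφ
  set ψ := Fintype.linearCombination (CoordRing K) s with hψ
  have hsub : LinearMap.ker ψ ≤ idealOfVars (Fin 3) K • LinearMap.ker ψ := by
    intro w hw
    have h1 : ∀ k, w k ∈ idealOfVars (Fin 3) K ^ (0 + 1) := by
      intro k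
      rw [mem_pow_idealOfVars_iff']
      intro x hx
      obtain rfl : x = 0 := (Finsupp.degree_eq_zero_iff x).mp (by lia)
      exact hmin w hw k
    choose a _ ha using fun k => exists_eq_of_mem_pow (h1 k)
    have h2 : w = (X 0 : CoordRing K) • (fun k => a k 0) + (X 1 : CoordRing K) • (fun k => a k 1) +
      (X 2 : CoordRing K) • (fun k => a k 2) := funext ha
    have h3 : ∀ j, X 0 * ψ (fun k => a k 0) j + X 1 * ψ (fun k => a k 1) j +
        X 2 * ψ (fun k => a k 2) j = 0 := by
      intro j
      have h4 := congrFun (LinearMap.mem_ker.mp hw) j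
      rw [h2, map_add, map_add, map_smul, map_smul, map_smul] at h4
      exact h4
    choose P _ Q _ T _ hP hQ hT using fun j => koszul_one (k := 0) (by simp) (by simp) (h3 j)
    have hz : ∀ a, φ (ψ a) = 0 := fun a => by
      rw [← LinearMap.mem_ker, ← hs]
      exact LinearMap.mem_range_self _ _
    have e0 : ψ (fun k => a k 0) = (X 1 : CoordRing K) • P + (X 2 : CoordRing K) • Q := funext hP
    have e1 : ψ (fun k => a k 1) = - ((X 0 : CoordRing K) • P) + (X 2 : CoordRing K) • T :=
      funext hQ
    have e2 : ψ (fun k => a k 2) = - ((X 0 : CoordRing K) • Q) - (X 1 : CoordRing K) • T :=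
      funext hT
    have f1 := congrArg φ e1
    have f2 := congrArg φ e2
    rw [hz] at f1 f2
    simp only [map_add, map_sub, map_neg, map_smul, smul_eq_mul] at f1 f2
    obtain ⟨w', p1, p2, p3⟩ := koszul_two (p := φ P) (q := φ Q) (s := φ T)
      (by linear_combination f1) (by linear_combination f2)
    have hmem : ∀ v, φ v ∈ I := fun v => by rw [← hI]; exact LinearMap.mem_range_self _ _
    -- The product of the linear form with `w'` is a combination of values of `φ`.
    have hw' : w' ∈ I := by
      apply hnz
      simp only [Fin.sum_univ_three, smul_eq_C_mul]
      convert sub_mem (add_mem (I.mul_mem_left (C (c 0)) (hmem T))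
        (I.mul_mem_left (C (c 2)) (hmem P))) (I.mul_mem_left (C (c 1)) (hmem Q)) using 1
      rw [p1, p2, p3]
      ring
    rw [← hI] at hw'
    obtain ⟨ω, rfl⟩ := hw'
    have k1 : P - (X 2 : CoordRing K) • ω ∈ LinearMap.ker φ := by
      rw [LinearMap.mem_ker, map_sub, map_smul, p1, smul_eq_mul, sub_self]
    have k2 : Q + (X 1 : CoordRing K) • ω ∈ LinearMap.ker φ := by
      rw [LinearMap.mem_ker, map_add, map_smul, p2, smul_eq_mul, neg_add_cancel]
    have k3 : T - (X 0 : CoordRing K) • ω ∈ LinearMap.ker φ := by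
      rw [LinearMap.mem_ker, map_sub, map_smul, p3, smul_eq_mul, sub_self]
    rw [← hs] at k1 k2 k3
    obtain ⟨α, hα⟩ := k1
    obtain ⟨β, hβ⟩ := k2
    obtain ⟨γ, hγ⟩ := k3
    rw [h2]
    refine mem_smul_ker ψ (p := α) (q := β) (s := γ) ?_ ?_ ?_
    · rw [e0, hα, hβ]; module
    · rw [e1, hα, hγ]; module
    · rw [e2, hβ, hγ]; module
  have hpow : ∀ k, ∀ w ∈ LinearMap.ker ψ, ∀ j, w j ∈ idealOfVars (Fin 3) K ^ k := by
    intro k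
    induction k with
    | zero => simp
    | succ k ih =>
      intro w hw j
      obtain ⟨n, hn, rfl⟩ := mem_idealOfVars_smul_iff.mp (hsub hw)
      rw [Finset.sum_apply, pow_succ']
      exact Submodule.sum_mem _ fun i _ =>
        Ideal.mul_mem_mul (Ideal.subset_span ⟨i, rfl⟩) (ih _ (hn i) j)
  rw [eq_bot_iff]
  intro w hw
  rw [Submodule.mem_bot]
  ext j x
  exact (mem_pow_idealOfVars_iff' _ _).mp (hpow (x.degree + 1) w hw j) x (Nat.lt_succ_self _)

lemma isHomogeneous_mem_pow {t k : ℕ} {f : CoordRing K} (hf : f.IsHomogeneous t) (h : k ≤ t) :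
    f ∈ idealOfVars (Fin 3) K ^ k := by
  rw [mem_pow_idealOfVars_iff']
  intro x hx
  by_contra hc
  have h1 : x.degree = t := by
    rw [Finsupp.degree_eq_weight_one]
    exact hf hc
  lia

/-- Bounds the degrees of first syzygies by r + 1. The images of the parts of `v` form a Koszul
boundary of some (p, q, s); dividing by the linear form modulo `I` shows that (p, q, s) is itself a
boundary modulo `I`, so the correction lifts through `φ`. -/
lemma mem_smul_syzygies {n r : ℕ} {I : Ideal (CoordRing K)} {c : Fin 3 → K}
    (hnz : ∀ f, (∑ i, c i • X i) * f ∈ I → f ∈ I)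
    (hr : ∀ f ∈ idealOfVars (Fin 3) K ^ r, ∃ g, f - (∑ i, c i • X i) * g ∈ I)
    {d : Fin n → ℕ} (hd : ∀ j, d j ≤ r)
    {g : Fin n → CoordRing K} (hg : ∀ j, (g j).IsHomogeneous (d j))
    (hI : LinearMap.range (Fintype.linearCombination (CoordRing K) g) = I)
    {v : Fin n → CoordRing K} (hv : v ∈ LinearMap.ker (Fintype.linearCombination (CoordRing K) g))
    (hvr : ∀ j, v j ∈ idealOfVars (Fin 3) K ^ (r + 2 - d j)) :
    v ∈ idealOfVars (Fin 3) K • LinearMap.ker (Fintype.linearCombination (CoordRing K) g) := by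
  set φ := Fintype.linearCombination (CoordRing K) g with hφ
  have hvr' : ∀ j, v j ∈ idealOfVars (Fin 3) K ^ ((r + 1 - d j) + 1) := fun j => by
    rw [← Nat.sub_add_comm (by have := hd j; lia)]
    exact hvr j
  choose a ha hav using fun j => exists_eq_of_mem_pow (hvr' j)
  have h2 : v = (X 0 : CoordRing K) • (fun k => a k 0) + (X 1 : CoordRing K) • (fun k => a k 1) +
      (X 2 : CoordRing K) • (fun k => a k 2) := funext hav
  have h3 : X 0 * φ (fun k => a k 0) + X 1 * φ (fun k => a k 1) + X 2 * φ (fun k => a k 2) = 0 := by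
    have h4 := LinearMap.mem_ker.mp hv
    rw [h2, map_add, map_add, map_smul, map_smul, map_smul] at h4
    exact h4
  have h4 : ∀ i, φ (fun k => a k i) ∈ idealOfVars (Fin 3) K ^ (r + 1) := by
    intro i
    rw [hφ, Fintype.linearCombination_apply]
    refine Submodule.sum_mem _ fun j _ => ?_
    have h5 := Ideal.mul_mem_mul (ha j i) (isHomogeneous_mem_pow (hg j) le_rfl)
    rwa [← pow_add, Nat.sub_add_cancel (by have := hd j; lia)] at h5
  -- One order is lost from r + 1, leaving 𝔪^r, exactly where `hr` applies.
  obtain ⟨p, hp, q, hq, s, hs, e0, e1, e2⟩ := koszul_one (h4 0) (h4 1) h3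
  rw [Nat.add_sub_cancel] at hp hq hs
  obtain ⟨p', hp'⟩ := hr p hp
  obtain ⟨q', hq'⟩ := hr q hq
  obtain ⟨s', hs'⟩ := hr s hs
  have hmem : ∀ v, φ v ∈ I := fun v => by rw [← hI]; exact LinearMap.mem_range_self _ _
  obtain ⟨w, w1, w2, w3⟩ := C_mul_sum_mem (I := I) (c := c) (p := p') (q := q') (s := s')
    (hnz _ (by
      convert sub_mem (hmem (fun k => a k 0)) (add_mem (I.mul_mem_left (X 1) hp')
        (I.mul_mem_left (X 2) hq')) using 1
      rw [e0]; ring))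
    (hnz _ (by
      convert sub_mem (hmem (fun k => a k 1)) (add_mem (I.mul_mem_left (- X 0) hp')
        (I.mul_mem_left (X 2) hs')) using 1
      rw [e1]; ring))
    (hnz _ (by
      convert sub_mem (hmem (fun k => a k 2)) (sub_mem (I.mul_mem_left (- X 0) hq')
        (I.mul_mem_left (X 1) hs')) using 1
      rw [e2]; ring))
  have k1 := add_mem hp' w1
  have k2 := add_mem hq' w2
  have k3 := add_mem hs' w3
  rw [← hI] at k1 k2 k3
  obtain ⟨α, hα⟩ := k1
  obtain ⟨β, hβ⟩ := k2
  obtain ⟨γ, hγ⟩ := k3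
  rw [h2]
  refine mem_smul_ker φ (p := α) (q := β) (s := γ) ?_ ?_ ?_
  · rw [e0, hα, hβ]; simp only [smul_eq_mul]; ring
  · rw [e1, hα, hγ]; simp only [smul_eq_mul]; ring
  · rw [e2, hβ, hγ]; simp only [smul_eq_mul]; ring

/-- A regularity criterion for homogeneous ideals of depth at least one. -/
theorem isRegularIdeal_of_nonzerodivisor {I : Ideal (CoordRing K)}
    (hI : ∀ f ∈ I, ∀ t, homogeneousComponent t f ∈ I) {r : ℕ} {c : Fin 3 → K}
    (hnz : ∀ f, (∑ i, c i • X i) * f ∈ I → f ∈ I)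
    (hr : ∀ f ∈ idealOfVars (Fin 3) K ^ r, ∃ g, f - (∑ i, c i • X i) * g ∈ I) :
    IsRegularIdeal I r := by
  have hl : ∑ i, c i • X i ∈ idealOfVars (Fin 3) K := Submodule.sum_mem _ fun i _ => by
    rw [smul_eq_C_mul]
    exact Ideal.mul_mem_left _ _ (Ideal.subset_span ⟨i, rfl⟩)
  obtain ⟨n, d, g, ⟨hgd, hgI⟩, hdr, hgmin⟩ := polyComponents.exists_minimal_generates
    (N := I) (IsNoetherian.noetherian I) hI (D := r) (fun v hv t ht hvt =>
      mem_smul_of_mem_pow hl hnz hr hv (isHomogeneous_mem_pow (t := t)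
        (hvt ▸ homogeneousComponent_isHomogeneous t v) ht))
  have hgh : ∀ j, (g j).IsHomogeneous (d j) := fun j =>
    hgd j ▸ homogeneousComponent_isHomogeneous (d j) (g j)
  set φ := Fintype.linearCombination (CoordRing K) g with hφ
  have hφI : LinearMap.range φ = I := by rw [hφ, Fintype.range_linearCombination, hgI]
  have hcomp : ∀ v t, φ ((shiftComponents d).proj t v) = homogeneousComponent t (φ v) := by
    intro v t
    rw [hφ, Fintype.linearCombination_apply, Fintype.linearCombination_apply, map_sum]
    refine Finset.sum_congr rfl fun j _ => ?_
    rw [shiftComponents_proj, smul_eq_mul, smul_eq_mul, mul_comm (v j),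
      homogeneousComponent_mul_of_left (hgh j)]
    split_ifs
    · rw [mul_comm]
    · rw [zero_mul]
  obtain ⟨m, e, s, ⟨hsd, hsN⟩, her, hsmin⟩ := (shiftComponents d).exists_minimal_generates
    (N := LinearMap.ker φ) (IsNoetherian.noetherian _) (fun v hv t => by
      rw [LinearMap.mem_ker] at hv ⊢
      rw [hcomp, hv, map_zero]) (D := r + 1) (fun v hv t ht hvt => by
      refine mem_smul_syzygies hnz hr hdr hgh hφI hv fun j => ?_
      rw [← hvt, shiftComponents_proj]
      split_ifs
      · exact isHomogeneous_mem_pow (homogeneousComponent_isHomogeneous _ _) (by lia)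
      · exact Submodule.zero_mem _)
  have hψ : LinearMap.range (Fintype.linearCombination (CoordRing K) s) = LinearMap.ker φ := by
    rw [Fintype.range_linearCombination, hsN]
  have hbot := linearCombination_ker_eq_bot hnz hφI hψ (fun w hw => hsmin w hw)
  have hsker : ∀ k, s k ∈ LinearMap.ker φ := fun k => hsN ▸ Submodule.subset_span ⟨k, rfl⟩
  refine ⟨resolutionOfInjective (g := g) (s := s) (d := d) (e := e) hgh ?_ hgI ?_ ?_ ?_, ?_⟩
  · intro j k hjk
    have h1 := congrFun (hsd k) j
    rw [shiftComponents_proj] at h1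
    split_ifs at h1 with h2
    · exact ⟨e k - d j, by lia, h1 ▸ homogeneousComponent_isHomogeneous _ _⟩
    · exact absurd h1.symm hjk
  · intro v
    have h1 : v ∈ LinearMap.range (Fintype.linearCombination (CoordRing K) s) ↔
      v ∈ LinearMap.ker φ := by rw [hψ]
    exact h1.symm
  · intro w hw
    have : w ∈ LinearMap.ker (Fintype.linearCombination (CoordRing K) s) := hw
    rwa [hbot] at this
  · intro j k
    exact hgmin _ (hsker k) j
  · intro i j
    match i, j with
    | 0, j => exact_mod_cast hdr j
    | 1, j => exact_mod_cast her j
    | i + 2, j => exact j.elim0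

end Plane

end

/-! ### Growth of the spaces of values and upper bounds -/

noncomputable section
namespace Plane
open MvPolynomial Module
variable {K : Type u} [Field K]

lemma finrank_grading (n : ℕ) : finrank K (grading K n) = (2 + n).choose n := by
  classical
  have h1 : grading K n = AddMonoidAlgebra.supported K K {d : Fin 3 →₀ ℕ | d.degree = n} :=
    homogeneousSubmodule_eq_finsupp_supported (Fin 3) K n
  have h2 : {d : Fin 3 →₀ ℕ | d.degree = n} =
      ((Finset.univ : Finset (Fin 3)).finsuppAntidiag n : Set (Fin 3 →₀ ℕ)) := by
    ext d
    simp [Finset.mem_finsuppAntidiag, Finsupp.degree_eq_sum]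
  rw [h1, h2, (AddMonoidAlgebra.supportedEquivFinsupp _).finrank_eq, Module.finrank_finsupp_self,
    ← Nat.card_eq_fintype_card, Nat.card_coe_set_eq, Set.ncard_coe_finset,
    Finset.card_finsuppAntidiag_nat_eq_choose]
  simp

instance (n : ℕ) : Module.Finite K (grading K n) :=
  Module.Finite.iff_fg.mpr (homogeneousSubmodule_fg (Fin 3) K n)

section Core

variable {B : Type*} [CommRing B] [Algebra K B] (δ : CoordRing K →ₐ[K] B)

/-- The ideal generated by the forms that `δ` maps to zero. -/
def formsIdeal : Ideal (CoordRing K) := Ideal.span {f | ∃ n, f ∈ grading K n ∧ δ f = 0}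

/-- The values of the forms of degree `n`. -/
def values (n : ℕ) : Submodule K B := (grading K n).map δ.toLinearMap

variable {δ}

lemma apply_mem_values {n : ℕ} {f : CoordRing K} (hf : f ∈ grading K n) : δ f ∈ values δ n :=
  ⟨f, hf, rfl⟩

/-- The kernel of `δ` contains l - 1 and need not be homogeneous; this ideal is its largest
homogeneous subideal. -/
lemma mem_formsIdeal_iff {f : CoordRing K} :
    f ∈ formsIdeal δ ↔ ∀ t, δ (homogeneousComponent t f) = 0 := by
  constructor
  · intro h t
    induction h using Submodule.span_induction generalizing t with
    | zero => simp
    | add x y _ _ hx hy => rw [map_add, map_add, hx t, hy t, add_zero]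
    | mem x hx =>
      obtain ⟨n, hn, hx⟩ := hx
      rw [homogeneousComponent_of_mem hn]
      split_ifs
      · exact hx
      · exact map_zero _
    | smul a x hx ih =>
      conv_lhs => rw [← sum_homogeneousComponent a]
      rw [smul_eq_mul, Finset.sum_mul, map_sum, map_sum]
      refine Finset.sum_eq_zero fun i _ => ?_
      rw [homogeneousComponent_mul_of_left (homogeneousComponent_isHomogeneous i a)]
      split_ifs
      · rw [map_mul, ih (t - i), mul_zero]
      · exact map_zero _
  · intro h
    rw [← sum_homogeneousComponent f]
    exact Submodule.sum_mem _ fun i _ =>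
      Ideal.subset_span ⟨i, homogeneousComponent_mem i f, h i⟩

lemma homogeneousComponent_mem_formsIdeal {f : CoordRing K} (hf : f ∈ formsIdeal δ) (t : ℕ) :
    homogeneousComponent t f ∈ formsIdeal δ :=
  Ideal.subset_span ⟨t, homogeneousComponent_mem t f, mem_formsIdeal_iff.mp hf t⟩

lemma values_eq_pow (n : ℕ) : values δ n = values δ 1 ^ n := by
  rw [values, values, ← Submodule.map_pow]
  congr 1
  exact (homogeneousSubmodule_one_pow ..).symm

variable {l : CoordRing K} (hl : l ∈ grading K 1) (hδl : δ l = 1)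
include hl hδl

lemma mem_formsIdeal_of_mul_mem {f : CoordRing K} (hf : l * f ∈ formsIdeal δ) :
    f ∈ formsIdeal δ := by
  rw [mem_formsIdeal_iff] at hf ⊢
  intro t
  have := hf (t + 1)
  rwa [homogeneousComponent_mul_of_left hl, if_pos (Nat.le_add_left 1 t), Nat.add_sub_cancel,
    map_mul, hδl, one_mul] at this

lemma values_mono : Monotone (values δ) := by
  refine monotone_nat_of_le_succ fun n => ?_
  rintro _ ⟨f, hf, rfl⟩
  refine ⟨l * f, ?_, ?_⟩
  · rw [add_comm]
    exact SetLike.mul_mem_graded hl hf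
  · change δ (l * f) = δ f
    rw [map_mul, hδl, one_mul]

/-- The values in degree n are the n-th power of those in degree one, so one equality makes the
chain stationary, while its union is all of `B`. -/
lemma values_eq_top_of_eq (hδ : Function.Surjective δ) {t : ℕ}
    (h : values δ t = values δ (t + 1)) : values δ t = ⊤ := by
  have hmono := values_mono hl hδl
  have h1 : ∀ k, values δ (t + k) = values δ t := by
    intro k
    induction k with
    | zero => rfl
    | succ k ih =>
      rw [← add_assoc, values_eq_pow, pow_succ, ← values_eq_pow, ih, values_eq_pow t, ← pow_succ,
        ← values_eq_pow, ← values_eq_pow, h]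
  rw [eq_top_iff]
  intro b _
  obtain ⟨f, rfl⟩ := hδ b
  rw [← sum_homogeneousComponent f, map_sum]
  refine Submodule.sum_mem _ fun i _ => ?_
  rw [← h1 i]
  exact hmono (Nat.le_add_left i t) (apply_mem_values (homogeneousComponent_mem i f))

lemma values_eq_top_or [Module.Finite K B] (hδ : Function.Surjective δ) {t₀ c : ℕ}
    (h : t₀ + c ≤ finrank K (values δ t₀)) (k : ℕ) :
    values δ (t₀ + k) = ⊤ ∨ t₀ + k + c ≤ finrank K (values δ (t₀ + k)) := by
  induction k with
  | zero => exact Or.inr h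
  | succ k ih =>
    have hle := values_mono hl hδl (Nat.le_succ (t₀ + k))
    by_cases heq : values δ (t₀ + k) = values δ (t₀ + k + 1)
    · left
      exact top_le_iff.mp (values_eq_top_of_eq hl hδl hδ heq ▸ hle)
    · rcases ih with ih | ih
      · left
        exact top_le_iff.mp (ih ▸ hle)
      · right
        have := Submodule.finrank_lt_finrank_of_lt (lt_of_le_of_ne hle heq)
        rw [Nat.succ_eq_add_one, ← add_assoc] at *
        lia

lemma values_eq_top [Module.Finite K B] (hδ : Function.Surjective δ) {t₀ c : ℕ}
    (h : t₀ + c ≤ finrank K (values δ t₀)) (hd : t₀ + c ≤ finrank K B) :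
    values δ (finrank K B - c) = ⊤ := by
  have h1 := values_eq_top_or hl hδl hδ h (finrank K B - c - t₀)
  rw [show t₀ + (finrank K B - c - t₀) = finrank K B - c by lia] at h1
  rcases h1 with h1 | h1
  · exact h1
  · apply Submodule.eq_top_of_finrank_eq
    have := Submodule.finrank_le (values δ (finrank K B - c))
    lia

/-- A form of degree i > t has the same value as some form `g` of degree i - 1, so it equals l g
modulo the ideal. This is the hypothesis of the criterion with r = t + 1. -/
lemma isRegularIdeal_of_values_eq_top {t : ℕ} (h : values δ t = ⊤) :
    IsRegularIdeal (formsIdeal δ) ((t : ℤ) + 1) := by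
  obtain ⟨c, hc⟩ := linear_eq_sum hl
  refine isRegularIdeal_of_nonzerodivisor (r := t + 1) (c := c)
    (fun f hf t => homogeneousComponent_mem_formsIdeal hf t)
    (fun f hf => mem_formsIdeal_of_mul_mem hl hδl (by rwa [hc])) (fun f hf => ?_)
  rw [← hc]
  have h1 : ∀ i, ∃ g, homogeneousComponent i f - l * g ∈ formsIdeal δ := by
    intro i
    by_cases hi : i ≤ t
    · refine ⟨0, ?_⟩
      rw [mul_zero, sub_zero]
      convert Ideal.zero_mem _
      ext x
      rw [coeff_homogeneousComponent, coeff_zero]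
      split_ifs with hx
      · exact (mem_pow_idealOfVars_iff' _ _).mp hf x (by lia)
      · rfl
    · have h2 : δ (homogeneousComponent i f) ∈ values δ (i - 1) :=
        values_mono hl hδl (show t ≤ i - 1 by lia) (h ▸ Submodule.mem_top)
      obtain ⟨g, hg, hgf⟩ := h2
      refine ⟨g, Ideal.subset_span ⟨i, sub_mem (homogeneousComponent_mem i f) ?_, ?_⟩⟩
      · have := SetLike.mul_mem_graded hl hg
        rwa [show 1 + (i - 1) = i by lia] at this
      · rw [map_sub, map_mul, hδl, one_mul]
        exact sub_eq_zero.mpr hgf.symm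
  choose g hg using h1
  refine ⟨∑ i ∈ Finset.range (f.totalDegree + 1), g i, ?_⟩
  have h2 := sum_homogeneousComponent f
  set N := f.totalDegree + 1
  rw [← h2, Finset.mul_sum, ← Finset.sum_sub_distrib]
  exact Submodule.sum_mem _ fun i _ => hg i

theorem isRegularIdeal_finrank [Module.Finite K B] (hδ : Function.Surjective δ) :
    IsRegularIdeal (formsIdeal δ) (finrank K B) := by
  rcases subsingleton_or_nontrivial B with hB | hB
  -- For empty `X` the bound t + 1 is at least 1, too weak; the criterion applies directly with r =
  -- 0, the ideal being everything.
  · obtain ⟨c, hc⟩ := linear_eq_sum hl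
    rw [finrank_zero_of_subsingleton]
    exact isRegularIdeal_of_nonzerodivisor (r := 0) (c := c)
      (fun f hf t => homogeneousComponent_mem_formsIdeal hf t)
      (fun f hf => mem_formsIdeal_of_mul_mem hl hδl (by rwa [hc])) (fun f _ => ⟨0, by
        rw [mem_formsIdeal_iff]
        exact fun t => Subsingleton.elim _ _⟩)
  · have h1 : 0 < finrank K B := finrank_pos
    have h2 : 0 + 1 ≤ finrank K (values δ 0) := by
      have : (1 : B) ∈ values δ 0 := ⟨1, isHomogeneous_one _ _, map_one δ⟩
      exact finrank_pos_iff_exists_ne_zero.mpr ⟨⟨1, this⟩, fun h => one_ne_zero (Subtype.ext_iff.mp h)⟩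
    have h3 := isRegularIdeal_of_values_eq_top hl hδl (values_eq_top hl hδl hδ h2 (by lia))
    convert h3 using 1
    lia

end Core
end Plane

end

/-! ### Vanishing forms, socles, and subschemes on no line -/

noncomputable section
namespace Plane
open MvPolynomial Module
variable {K : Type u} [Field K]

section Core

variable {B : Type*} [CommRing B] [Algebra K B] {δ : CoordRing K →ₐ[K] B}

/-- The forms of degree `n` that `δ` maps to zero. -/
def vanishingForms (δ : CoordRing K →ₐ[K] B) (n : ℕ) : Submodule K (CoordRing K) :=
  grading K n ⊓ LinearMap.ker δ.toLinearMap

instance (n : ℕ) : Module.Finite K (vanishingForms δ n) :=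
  Submodule.finiteDimensional_of_le (inf_le_left (a := grading K n))

lemma mem_vanishingForms {n : ℕ} {f : CoordRing K} (hf : f ∈ grading K n) (h : δ f = 0) :
    f ∈ vanishingForms δ n := ⟨hf, h⟩

lemma finrank_values_add_finrank_vanishingForms (n : ℕ) :
    finrank K (values δ n) + finrank K (vanishingForms δ n) = (2 + n).choose n := by
  rw [← finrank_grading (K := K) n,
    ← LinearMap.finrank_range_add_finrank_ker (δ.toLinearMap.domRestrict (grading K n)),
    LinearMap.range_domRestrict, vanishingForms, ← Submodule.map_comap_subtype,
    Submodule.finrank_map_subtype_eq]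
  rfl

lemma finrank_values_one (h : ∀ m ∈ grading K 1, δ m = 0 → m = 0) :
    finrank K (values δ 1) = 3 := by
  have h1 := finrank_values_add_finrank_vanishingForms (δ := δ) 1
  rwa [show vanishingForms δ 1 = ⊥ from (Submodule.eq_bot_iff _).mpr fun m hm => h m hm.1 hm.2,
    finrank_bot] at h1

lemma exists_linearIndependent_pair {V : Type*} [AddCommGroup V] [Module K V] {W : Submodule K V}
    (h : 1 < finrank K W) : ∃ a ∈ W, ∃ b ∈ W, LinearIndependent K ![a, b] := by
  have : Nontrivial W := nontrivial_of_finrank_pos (R := K) (by lia)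
  obtain ⟨a, ha⟩ := exists_ne (0 : W)
  obtain ⟨b, hab⟩ := exists_linearIndependent_pair_of_one_lt_finrank h ha
  refine ⟨a, a.2, b, b.2, ?_⟩
  rw [LinearIndependent.pair_iff] at hab ⊢
  exact fun s t hst => hab s t (Subtype.ext hst)

/-- The socle of a nonzero finite algebra over an algebraically closed field is nonzero. -/
lemma exists_socle_element [IsAlgClosed K] [Module.Finite K B] [Nontrivial B] :
    ∃ b : B, b ≠ 0 ∧ ∀ x, ∃ k : K, x * b = k • b := by
  have : IsNoetherianRing B := isNoetherian_of_tower K inferInstance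
  -- An associated prime is the annihilator of some `b`, and B/p, a domain finite over K, is K
  -- itself.
  obtain ⟨p, hp⟩ := associatedPrimes.nonempty B B
  obtain ⟨hprime, b, hb⟩ := (isAssociatedPrime_iff (R := B)).mp hp
  have hb' : ∀ x, x ∈ p ↔ x * b = 0 := by
    intro x
    rw [hb, Submodule.mem_colon_singleton]
    simp
  refine ⟨b, ?_, fun x => ?_⟩
  · rintro rfl
    exact hprime.ne_top ((Ideal.eq_top_iff_one p).mpr ((hb' 1).mpr (mul_zero 1)))
  · obtain ⟨k, hk⟩ := (IsAlgClosed.algebraMap_bijective_of_isIntegral (k := K) (K := B ⧸ p)).2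
      (Ideal.Quotient.mk p x)
    refine ⟨k, ?_⟩
    have h1 : Ideal.Quotient.mk p (x - algebraMap K B k) = 0 := by
      rw [map_sub, ← hk]
      exact sub_self _
    rw [Ideal.Quotient.eq_zero_iff_mem, hb', sub_mul, ← Algebra.smul_def] at h1
    exact sub_eq_zero.mp h1

lemma finrank_add_one_of_socle [Module.Finite K B] {B' : Type*} [CommRing B'] [Algebra K B']
    (θ : B →ₐ[K] B') (hθ : Function.Surjective θ) {b : B} (hb : b ≠ 0)
    (hker : ∀ x, θ x = 0 ↔ b ∣ x) (hsoc : ∀ x, ∃ k : K, x * b = k • b) :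
    finrank K B' + 1 = finrank K B := by
  have h1 : LinearMap.ker θ.toLinearMap = K ∙ b := by
    ext x
    rw [LinearMap.mem_ker, Submodule.mem_span_singleton]
    refine (hker x).trans ⟨?_, ?_⟩
    · rintro ⟨y, rfl⟩
      obtain ⟨k, hk⟩ := hsoc y
      exact ⟨k, by rw [← hk, mul_comm]⟩
    · rintro ⟨k, rfl⟩
      rw [Algebra.smul_def]
      exact dvd_mul_left b _
  have h2 := LinearMap.finrank_range_add_finrank_ker θ.toLinearMap
  rw [h1, finrank_span_singleton hb, LinearMap.range_eq_top.mpr hθ, finrank_top] at h2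
  exact h2

variable {l : CoordRing K} (hl : l ∈ grading K 1) (hδl : δ l = 1)
include hl hδl

lemma isRegularIdeal_of_finrank_values [Module.Finite K B] (hδ : Function.Surjective δ) {t c : ℕ}
    (h : t + c ≤ finrank K (values δ t)) :
    IsRegularIdeal (formsIdeal δ) ((finrank K B : ℤ) - c + 1) := by
  have h1 := h.trans (Submodule.finrank_le (values δ t))
  have h2 := isRegularIdeal_of_values_eq_top hl hδl (values_eq_top hl hδl hδ h h1)
  rwa [Nat.cast_sub (by lia)] at h2

theorem isRegularIdeal_finrank_sub_one [Module.Finite K B] (hδ : Function.Surjective δ)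
    (h : ∀ m ∈ grading K 1, δ m = 0 → m = 0) :
    IsRegularIdeal (formsIdeal δ) ((finrank K B : ℤ) - 1) := by
  have h1 := isRegularIdeal_of_finrank_values hl hδl hδ (t := 1) (c := 2)
    (finrank_values_one h).ge
  convert h1 using 1
  push_cast
  ring

end Core
end Plane

end

/-! ### The lower bound for subschemes of a line -/

noncomputable section
namespace Plane
open MvPolynomial Module
variable {K : Type u} [Field K]

section Core

variable {B : Type*} [CommRing B] [Algebra K B] {δ : CoordRing K →ₐ[K] B}
variable {l : CoordRing K} (hl : l ∈ grading K 1) (hδl : δ l = 1)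
include hl hδl

/-- If `δ` kills a linear form, then it factors through the evaluation of polynomials in one
variable. -/
lemma exists_factorization [Nontrivial B] {m : CoordRing K} (hm : m ∈ grading K 1) (hm0 : m ≠ 0)
    (hδm : δ m = 0) : ∃ (y : CoordRing K) (ρ : CoordRing K →ₐ[K] Polynomial K),
      y ∈ grading K 1 ∧ ρ l = 1 ∧ ρ y = Polynomial.X ∧ (∀ f, Polynomial.aeval (δ y) (ρ f) = δ f) ∧
      ∀ n, ∀ f ∈ grading K n, (ρ f).natDegree ≤ n := by
  have hdim : finrank K (grading K 1) = 3 := finrank_grading 1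
  have hlin : LinearIndependent K ![(⟨l, hl⟩ : grading K 1), ⟨m, hm⟩] := by
    rw [LinearIndependent.pair_iff]
    intro s t hst
    have h1 : s • l + t • m = 0 := congrArg Subtype.val hst
    have h2 : s = 0 := by
      have := congrArg δ h1
      rw [map_add, map_smul, map_smul, hδl, hδm, smul_zero, add_zero, map_zero] at this
      exact (smul_eq_zero.mp this).resolve_right one_ne_zero
    rw [h2, zero_smul, zero_add] at h1
    exact ⟨h2, (smul_eq_zero.mp h1).resolve_right hm0⟩
  -- In the basis y, l, m of the linear forms, `ρ` takes the values X, 1, 0: it restricts to the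
  -- line and dehomogenizes by `l`.
  obtain ⟨⟨y, hy⟩, hy'⟩ := exists_linearIndependent_cons_of_lt_finrank hlin (by lia)
  let b := basisOfLinearIndependentOfCardEqFinrank hy' (by rw [hdim]; rfl)
  let φ : grading K 1 →ₗ[K] Polynomial K := b.constr K ![Polynomial.X, 1, 0]
  let ρ : CoordRing K →ₐ[K] Polynomial K := aeval fun i => φ ⟨X i, X_mem_grading i⟩
  have hb : ∀ i, b i = (Fin.cons ⟨y, hy⟩ ![(⟨l, hl⟩ : grading K 1), ⟨m, hm⟩] : Fin 3 → _) i :=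
    fun i => by rw [coe_basisOfLinearIndependentOfCardEqFinrank]
  have hφ : ∀ i, φ (b i) = (![Polynomial.X, 1, 0] : Fin 3 → Polynomial K) i :=
    fun i => b.constr_basis K _ i
  have hρ : ∀ v : grading K 1, ρ v = φ v := by
    rintro ⟨v, hv⟩
    obtain ⟨c, rfl⟩ := linear_eq_sum hv
    have : (⟨_, hv⟩ : grading K 1) = ∑ i, c i • ⟨X i, X_mem_grading i⟩ := by
      ext1
      simp
    rw [this, map_sum]
    simp only [map_sum, map_smul, AddSubmonoidClass.coe_finsetSum, SetLike.val_smul, ρ, aeval_X]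
  have hδφ : ∀ v : grading K 1, Polynomial.aeval (δ y) (φ v) = δ v := by
    have : (Polynomial.aeval (δ y)).toLinearMap ∘ₗ φ =
        δ.toLinearMap ∘ₗ (grading K 1).subtype := by
      refine b.ext fun i => ?_
      change Polynomial.aeval (δ y) (φ (b i)) = δ (b i)
      rw [hφ, hb]
      fin_cases i
      · simp
      · simp [hδl]
      · simp [hδm]
    exact fun v => LinearMap.congr_fun this v
  refine ⟨y, ρ, hy, ?_, ?_, fun f => ?_, fun n f hf => ?_⟩
  · have := hφ 1
    rw [hb, ← hρ] at this
    exact this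
  · have := hφ 0
    rw [hb, ← hρ] at this
    exact this
  · have : (Polynomial.aeval (δ y)).comp ρ = δ := by
      ext i
      rw [AlgHom.comp_apply, aeval_X]
      exact hδφ _
    exact AlgHom.congr_fun this f
  · have h1 := aeval_natDegree_le (F := f) (m := n) (n := 1) (hf.totalDegree_le)
      (fun i => φ ⟨X i, X_mem_grading i⟩) (fun i => ?_)
    · rwa [mul_one] at h1
    · rw [show φ _ = _ from b.constr_apply_fintype K _ _]
      refine Polynomial.natDegree_sum_le_of_forall_le _ _ fun j _ => ?_
      refine (Polynomial.natDegree_smul_le _ _).trans ?_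
      fin_cases j <;> simp

/-- The value of y generates `B`, so no nonzero polynomial of degree below dim B kills it.
Generators of degree below dim B would all be killed by `ρ`, but the homogenized minimal polynomial
of δ(y) lies in the ideal and is not. -/
theorem finrank_le_of_isRegularIdeal [Module.Finite K B] (hδ : Function.Surjective δ)
    {m : CoordRing K} (hm : m ∈ grading K 1) (hm0 : m ≠ 0) (hδm : δ m = 0) {r : ℤ}
    (hr : IsRegularIdeal (formsIdeal δ) r) : (finrank K B : ℤ) ≤ r := by
  by_contra! hlt
  obtain ⟨F, hF⟩ := hr
  have hdeg : ∀ j, F.deg 0 j < finrank K B := fun j => by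
    have := hF 0 j
    lia
  have hgen : ∀ j, δ (F.gen j) = 0 := by
    intro j
    have h1 : F.gen j ∈ formsIdeal δ := F.span_gen.le (Ideal.subset_span ⟨j, rfl⟩)
    have h2 := mem_formsIdeal_iff.mp h1 (F.deg 0 j)
    rwa [homogeneousComponent_of_mem (F.gen_homogeneous j), if_pos rfl] at h2
  rcases subsingleton_or_nontrivial B with hB | hB
  · rw [finrank_zero_of_subsingleton] at hdeg
    -- No degree is negative, so the ideal would be zero, although it contains `m`.
    have : IsEmpty (Fin (F.rank 0)) := ⟨fun j => absurd (hdeg j) (by lia)⟩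
    have h1 : m ∈ formsIdeal δ := Ideal.subset_span ⟨1, hm, hδm⟩
    rw [← F.span_gen, Set.range_eq_empty, Ideal.span_empty] at h1
    exact hm0 h1
  obtain ⟨y, ρ, hy, hρl, hρy, hρδ, hρd⟩ := exists_factorization hl hδl hm hm0 hδm
  have hker : ∀ q : Polynomial K, q ≠ 0 → Polynomial.aeval (δ y) q = 0 →
      finrank K B ≤ q.natDegree := by
    intro q hq h0
    have : FiniteDimensional K (Polynomial K ⧸ Ideal.span {q}) :=
      (AdjoinRoot.powerBasis hq).finite
    rw [← finrank_quotient_span_eq_natDegree (f := q)]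
    let θ : (Polynomial K ⧸ Ideal.span {q}) →ₐ[K] B :=
      Ideal.Quotient.liftₐ _ (Polynomial.aeval (δ y)) fun a ha => by
        obtain ⟨c, rfl⟩ := Ideal.mem_span_singleton.mp ha
        rw [map_mul, h0, zero_mul]
    refine LinearMap.finrank_le_finrank_of_surjective (f := θ.toLinearMap) fun x => ?_
    obtain ⟨f, rfl⟩ := hδ x
    exact ⟨Ideal.Quotient.mk _ (ρ f), hρδ f⟩
  have hρ0 : ∀ f ∈ formsIdeal δ, ρ f = 0 := by
    have : formsIdeal δ ≤ RingHom.ker ρ := by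
      rw [← F.span_gen, Ideal.span_le]
      rintro _ ⟨j, rfl⟩
      by_contra h0
      have h1 := hker _ h0 ((hρδ _).trans (hgen j))
      have h2 := hρd _ _ (F.gen_homogeneous j)
      have h3 := hdeg j
      lia
    exact fun f hf => this hf
  set p := minpoly K (δ y)
  have hp0 : p ≠ 0 := minpoly.ne_zero (Algebra.IsIntegral.isIntegral _)
  set N := p.natDegree with hN
  let G : CoordRing K := ∑ k ∈ Finset.range (N + 1), p.coeff k • (y ^ k * l ^ (N - k))
  have hρG : ρ G = p := by
    conv_rhs => rw [p.as_sum_range]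
    rw [map_sum]
    refine Finset.sum_congr rfl fun k _ => ?_
    rw [map_smul, map_mul, map_pow, map_pow, hρl, hρy, one_pow, mul_one,
      Polynomial.smul_eq_C_mul, Polynomial.C_mul_X_pow_eq_monomial]
  have hG : G ∈ grading K N := by
    refine Submodule.sum_mem _ fun k hk => Submodule.smul_mem _ _ ?_
    have := SetLike.mul_mem_graded (SetLike.pow_mem_graded k hy) (SetLike.pow_mem_graded (N - k) hl)
    rw [Finset.mem_range] at hk
    rwa [smul_eq_mul, smul_eq_mul, mul_one, mul_one, show k + (N - k) = N by lia] at this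
  refine hp0 (hρG ▸ hρ0 G (Ideal.subset_span ⟨N, hG, ?_⟩))
  rw [← hρδ, hρG]
  exact minpoly.aeval K _

end Core
end Plane

end

/-! ### Common factors of conics and socle elements -/

noncomputable section
namespace Plane
open MvPolynomial Module
variable {K : Type u} [Field K]

lemma homogeneousComponent_eq_self {n : ℕ} {f : CoordRing K} (hf : f ∈ grading K n) :
    homogeneousComponent n f = f := by
  rw [homogeneousComponent_of_mem hf, if_pos rfl]

/-- Two independent quadratic forms have a common linear factor if their multiples by linear forms
span a space of dimension at most five. -/
lemma exists_common_factor {Q₁ Q₂ : CoordRing K} (hQ₁ : Q₁ ∈ grading K 2)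
    (hlin : LinearIndependent K ![Q₁, Q₂]) {W : Submodule K (CoordRing K)} [Module.Finite K W]
    (hW : finrank K W ≤ 5) (h₁ : ∀ a ∈ grading K 1, a * Q₁ ∈ W)
    (h₂ : ∀ a ∈ grading K 1, a * Q₂ ∈ W) :
    ∃ a b m, a ∈ grading K 1 ∧ b ∈ grading K 1 ∧ m ∈ grading K 1 ∧
      Q₁ = a * m ∧ Q₂ = b * m := by
  have hdim : finrank K (grading K 1) = 3 := finrank_grading 1
  let φ : grading K 1 × grading K 1 →ₗ[K] CoordRing K :=
    ((LinearMap.mulRight K Q₁).domRestrict (grading K 1)).coprod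
      ((LinearMap.mulRight K Q₂).domRestrict (grading K 1))
  -- The source has dimension 6 and the image at most 5, so there is a linear syzygy.
  have h3 : LinearMap.ker φ ≠ ⊥ := by
    intro h3
    have h4 := LinearMap.finrank_range_add_finrank_ker φ
    have h5 : LinearMap.range φ ≤ W := by
      rintro _ ⟨⟨a, b⟩, rfl⟩
      exact add_mem (h₁ a a.2) (h₂ b b.2)
    have h6 := Submodule.finrank_mono h5
    rw [h3, finrank_bot, Module.finrank_prod] at h4
    lia
  obtain ⟨⟨⟨a, ha⟩, ⟨b, hb⟩⟩, hab, hab0⟩ := (Submodule.ne_bot_iff _).mp h3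
  have hrel : a * Q₁ + b * Q₂ = 0 := hab
  have hb0 : b ≠ 0 := by
    rintro rfl
    rw [zero_mul, add_zero, mul_eq_zero] at hrel
    obtain rfl := hrel.resolve_right (hlin.ne_zero 0)
    exact hab0 rfl
  -- If `b` divided `a`, the quotient would be a constant and the two forms would be dependent.
  have hndvd : ¬ b ∣ a := by
    rintro ⟨c, rfl⟩
    have hc := homogeneousComponent_eq_self ha
    rw [homogeneousComponent_mul_of_left hb, if_pos le_rfl] at hc
    rw [← mul_left_cancel₀ hb0 hc, Nat.sub_self, homogeneousComponent_zero, mul_assoc, ← mul_add,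
      ← smul_eq_C_mul, mul_eq_zero, or_iff_right hb0] at hrel
    have := LinearIndependent.pair_iff.mp hlin (coeff 0 c) 1 (by rwa [one_smul])
    exact one_ne_zero this.2
  obtain ⟨m, rfl⟩ : b ∣ Q₁ :=
    ((prime_of_mem_grading_one hb hb0).dvd_or_dvd
      (show b ∣ a * Q₁ from ⟨-Q₂, by linear_combination hrel⟩)).resolve_left hndvd
  refine ⟨b, -a, m, hb, neg_mem ha, ?_, rfl, mul_left_cancel₀ hb0 ?_⟩
  · have hm := homogeneousComponent_eq_self hQ₁
    rw [homogeneousComponent_mul_of_left hb, if_pos one_le_two] at hm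
    rw [← mul_left_cancel₀ hb0 hm]
    exact homogeneousComponent_mem _ m
  · linear_combination hrel

section Core

variable {B : Type*} [CommRing B] [Algebra K B] {δ : CoordRing K →ₐ[K] B}
variable {l : CoordRing K} (hl : l ∈ grading K 1) (hδl : δ l = 1)
include hl hδl

/-- If `δ` maps the products of `m` with two independent linear forms to zero, then the multiples of
`δ m` are its scalar multiples. -/
lemma smul_of_mul_eq_zero (hδ : Function.Surjective δ)
    {a b m : CoordRing K} (ha : a ∈ grading K 1) (hb : b ∈ grading K 1)
    (hm0 : δ m ≠ 0)
    (hlin : LinearIndependent K ![a, b]) (ham : δ (a * m) = 0) (hbm : δ (b * m) = 0) (x : B) :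
    ∃ k : K, x * δ m = k • δ m := by
  have hlin3 : LinearIndependent K ![(⟨l, hl⟩ : grading K 1), ⟨a, ha⟩, ⟨b, hb⟩] := by
    rw [LinearIndependent.pair_iff] at hlin
    rw [Fintype.linearIndependent_iff]
    intro g hg
    have h1 : g 0 • l + g 1 • a + g 2 • b = 0 := by
      have := congrArg Subtype.val hg
      simpa [Fin.sum_univ_three] using this
    have h2 : g 0 = 0 := by
      have h2 := congrArg (fun f => δ (f * m)) h1
      simp only [add_mul, smul_mul_assoc, map_add, map_smul, ham, hbm, smul_zero, add_zero, map_mul,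
        hδl, one_mul, zero_mul, map_zero] at h2
      exact (smul_eq_zero.mp h2).resolve_right hm0
    rw [h2, zero_smul, zero_add] at h1
    have h3 := hlin _ _ h1
    intro i
    fin_cases i
    exacts [h2, h3.1, h3.2]
  have hspan := hlin3.span_eq_top_of_card_eq_finrank' (by
    rw [show finrank K (grading K 1) = 3 from finrank_grading 1]; rfl)
  -- The stabilizer of the line Kδ(m). It contains the values of the basis l, a, b, hence those of
  -- all polynomials.
  let T : Subalgebra K B :=
    { carrier := {x | ∃ k : K, x * δ m = k • δ m}
      mul_mem' := by
        rintro x y ⟨k, hk⟩ ⟨j, hj⟩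
        exact ⟨j * k, by rw [mul_assoc, hj, mul_smul_comm, hk, smul_smul]⟩
      add_mem' := by
        rintro x y ⟨k, hk⟩ ⟨j, hj⟩
        exact ⟨k + j, by rw [add_mul, hk, hj, add_smul]⟩
      algebraMap_mem' := fun k => ⟨k, by rw [Algebra.smul_def]⟩ }
  have h1 : (⊤ : Submodule K (grading K 1)) ≤
      T.toSubmodule.comap (δ.toLinearMap ∘ₗ (grading K 1).subtype) := by
    rw [← hspan, Submodule.span_le]
    rintro _ ⟨i, rfl⟩
    fin_cases i
    · exact ⟨1, by
        change δ l * δ m = _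
        rw [hδl, one_mul, one_smul]⟩
    · exact ⟨0, by
        change δ a * δ m = _
        rw [← map_mul, ham, zero_smul]⟩
    · exact ⟨0, by
        change δ b * δ m = _
        rw [← map_mul, hbm, zero_smul]⟩
  have h2 : ∀ f, δ f ∈ T := by
    intro f
    induction f using MvPolynomial.induction_on with
    | C c => exact (algHom_C δ c) ▸ T.algebraMap_mem c
    | add f g hf hg => exact map_add δ f g ▸ T.add_mem hf hg
    | mul_X f i hf => exact map_mul δ f _ ▸ T.mul_mem hf (h1 (x := ⟨X i, X_mem_grading i⟩) trivial)
  obtain ⟨f, rfl⟩ := hδ x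
  exact h2 f

theorem isRegularIdeal_or_exists_socle_element [IsAlgClosed K] [Module.Finite K B]
    (hδ : Function.Surjective δ) (hinj : ∀ m ∈ grading K 1, δ m = 0 → m = 0)
    (hd : finrank K B ≠ 4) :
    IsRegularIdeal (formsIdeal δ) ((finrank K B : ℤ) - 2) ∨
      ∃ m ∈ grading K 1, δ m ≠ 0 ∧ ∀ x, ∃ k : K, x * δ m = k • δ m := by
  have hv1 := finrank_values_one hinj
  have hd3 : 3 ≤ finrank K B := hv1 ▸ Submodule.finrank_le (values δ 1)
  by_cases hd3' : finrank K B = 3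
  · right
    have : Nontrivial B := nontrivial_of_finrank_pos (R := K) (by lia)
    obtain ⟨b, hb0, hb⟩ := exists_socle_element (K := K) (B := B)
    have htop : values δ 1 = ⊤ := Submodule.eq_top_of_finrank_eq (by lia)
    obtain ⟨m, hm, rfl⟩ : b ∈ values δ 1 := htop ▸ Submodule.mem_top
    exact ⟨m, hm, hb0, hb⟩
  have hreg : ∀ t, t + 3 ≤ finrank K (values δ t) →
      IsRegularIdeal (formsIdeal δ) ((finrank K B : ℤ) - 2) := by
    intro t ht
    have h1 := isRegularIdeal_of_finrank_values hl hδl hδ ht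
    convert h1 using 1
    push_cast
    ring
  by_cases h2 : 5 ≤ finrank K (values δ 2)
  · exact Or.inl (hreg 2 h2)
  by_cases h3 : 6 ≤ finrank K (values δ 3)
  · exact Or.inl (hreg 3 h3)
  right
  have h4 := finrank_values_add_finrank_vanishingForms (δ := δ) 2
  have h5 := finrank_values_add_finrank_vanishingForms (δ := δ) 3
  -- Here d ≠ 4 enters: the chain may already be all of `B`, and then its dimension d must be at
  -- least 5. For a complete intersection of two conics, d = 4 and there is no linear syzygy.
  have h6 : 5 ≤ finrank K (values δ 3) := by
    rcases values_eq_top_or hl hδl hδ (t₀ := 1) (c := 2) hv1.ge 2 with h | h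
    · rw [show 1 + 2 = 3 from rfl] at h
      rw [h, finrank_top]
      lia
    · exact h
  rw [show Nat.choose (2 + 2) 2 = 6 from rfl] at h4
  rw [show Nat.choose (2 + 3) 3 = 10 from rfl] at h5
  obtain ⟨Q₁, hQ₁, Q₂, hQ₂, hlin⟩ :=
    exists_linearIndependent_pair (show 1 < finrank K (vanishingForms δ 2) by lia)
  obtain ⟨a, b, m, ha, hb, hm, h7, h8⟩ := exists_common_factor hQ₁.1 hlin
    (W := vanishingForms δ 3) (by lia)
    (fun a ha => mem_vanishingForms (SetLike.mul_mem_graded ha hQ₁.1)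
      ((map_mul δ a _).trans (mul_eq_zero_of_right _ hQ₁.2)))
    (fun a ha => mem_vanishingForms (SetLike.mul_mem_graded ha hQ₂.1)
      ((map_mul δ a _).trans (mul_eq_zero_of_right _ hQ₂.2)))
  have hm0 : m ≠ 0 := by
    rintro rfl
    exact hlin.ne_zero 0 (h7.trans (mul_zero a))
  have hδm : δ m ≠ 0 := fun h => hm0 (hinj m hm h)
  refine ⟨m, hm, hδm, smul_of_mul_eq_zero hl hδl hδ ha hb hδm ?_ ?_ ?_⟩
  · rw [LinearIndependent.pair_iff] at hlin ⊢
    intro s t hst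
    refine hlin s t ?_
    rw [h7, h8, ← smul_mul_assoc, ← smul_mul_assoc, ← add_mul, hst, zero_mul]
  · rw [← h7]
    exact hQ₁.2
  · rw [← h8]
    exact hQ₂.2

end Core
end Plane

end

/-! ### Degrees, regularity and the three conclusions -/

noncomputable section
namespace Plane
open Module
variable {K : Type u} [Field K]

/-- The algebra of global functions of a closed subscheme. -/
abbrev ClosedSubscheme.algebra (X : ClosedSubscheme K) : Algebra K Γ(X.subscheme, ⊤) :=
  X.scalars.toAlgebra

attribute [local instance] ClosedSubscheme.algebra

/-- The evaluation on a subscheme of `D₊(l)` as a homomorphism of algebras. -/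
def evalAlgHom (Y : ClosedSubscheme K) {l : CoordRing K} (hl : l ∈ grading K 1)
    (hY : ⊤ = Y.subschemeι ⁻¹ᵁ Proj.basicOpen (grading K) l) :
    CoordRing K →ₐ[K] Γ(Y.subscheme, ⊤) :=
  { evalOn Y hl hY with commutes' := evalOn_C Y hl hY }

lemma evalAlgHom_apply (Y : ClosedSubscheme K) {l : CoordRing K} (hl : l ∈ grading K 1)
    (hY : ⊤ = Y.subschemeι ⁻¹ᵁ Proj.basicOpen (grading K) l) (f : CoordRing K) :
    evalAlgHom Y hl hY f = evalOn Y hl hY f := rfl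

lemma evalAlgHom_self (Y : ClosedSubscheme K) {l : CoordRing K} (hl : l ∈ grading K 1)
    (hY : ⊤ = Y.subschemeι ⁻¹ᵁ Proj.basicOpen (grading K) l) : evalAlgHom Y hl hY l = 1 := by
  rw [evalAlgHom_apply, evalOn, RingHom.comp_apply, dehom_self, map_one]

lemma degree_eq_finrank (Y : ClosedSubscheme K) :
    Y.degree = finrank K Γ(Y.subscheme, ⊤) := rfl

lemma finite_functions {X : ClosedSubscheme K} (hX : X.IsFiniteScheme) :
    Module.Finite K Γ(X.subscheme, ⊤) := finite_scalars hX

/-- Restriction of functions from `X` to the intersection is onto, with kernel the ideal generated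
by the value of `m`, which `hsoc` makes one-dimensional. -/
theorem degree_inter_line_add_one {X : ClosedSubscheme K} (hX : X.IsFiniteScheme)
    {l m : CoordRing K} (hl : l ∈ grading K 1) (hm : m ∈ grading K 1) (hl0 : l ≠ 0) (hm0 : m ≠ 0)
    (h : ∀ y : X.subscheme, X.subschemeι y ∈ Proj.basicOpen (grading K) l)
    (hne : evalAlgHom X hl (top_eq_preimage h) m ≠ 0)
    (hsoc : ∀ x, ∃ k : K, x * evalAlgHom X hl (top_eq_preimage h) m =
      k • evalAlgHom X hl (top_eq_preimage h) m) :
    ((line m).inter X).degree + 1 = X.degree := by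
  have := finite_functions hX
  have hsurj : Function.Surjective (evalAlgHom X hl (top_eq_preimage h)) :=
    evalOn_surjective X hl (top_eq_preimage h)
  let hMX := top_eq_preimage (inter_range (M := line m) h)
  have hker := evalOn_inter_line_eq_zero_iff hl hm hl0 hm0 (top_eq_preimage h) hMX
  have hle : RingHom.ker (evalAlgHom X hl (top_eq_preimage h)) ≤
      RingHom.ker (evalAlgHom ((line m).inter X) hl hMX) := by
    intro f hf
    refine (hker f).mpr ?_
    rw [show evalOn X hl (top_eq_preimage h) f = 0 from hf]
    exact dvd_zero _
  let θ := AlgHom.liftOfSurjective (evalAlgHom X hl (top_eq_preimage h)) hsurj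
    (evalAlgHom ((line m).inter X) hl hMX) hle
  have hθ : ∀ f, θ (evalAlgHom X hl (top_eq_preimage h) f) =
      evalAlgHom ((line m).inter X) hl hMX f :=
    fun f => AlgHom.liftOfSurjective_apply ..
  refine finrank_add_one_of_socle θ (fun x => ?_) hne (fun x => ?_) hsoc
  · obtain ⟨f, rfl⟩ := evalOn_surjective ((line m).inter X) hl hMX x
    exact ⟨_, hθ f⟩
  · obtain ⟨f, rfl⟩ := hsurj x
    rw [hθ]
    exact hker f

lemma homogeneousIdeal_eq_formsIdeal {X : ClosedSubscheme K} {l : CoordRing K}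
    (hl : l ∈ grading K 1)
    (h : ∀ y : X.subscheme, X.subschemeι y ∈ Proj.basicOpen (grading K) l) :
    X.homogeneousIdeal = formsIdeal (evalAlgHom X hl (top_eq_preimage h)) :=
  homogeneousIdeal_eq_span hl h

lemma natCast_eq_coe (n : ℕ) : (n : EReal) = (((n : ℤ) : ℝ) : EReal) := rfl

lemma reg_le {X : ClosedSubscheme K} {r : ℤ} (h : IsRegularIdeal X.homogeneousIdeal r) :
    X.reg ≤ ((r : ℝ) : EReal) := iInf₂_le r h

lemma le_reg {X : ClosedSubscheme K} {s : ℤ}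
    (h : ∀ r, IsRegularIdeal X.homogeneousIdeal r → s ≤ r) : ((s : ℝ) : EReal) ≤ X.reg :=
  le_iInf₂ fun r hr => EReal.coe_le_coe_iff.mpr (Int.cast_le.mpr (h r hr))

section Regularity

variable {X : ClosedSubscheme K} (hX : X.IsFiniteScheme) {l : CoordRing K} (hl : l ∈ grading K 1)
  (h : ∀ y : X.subscheme, X.subschemeι y ∈ Proj.basicOpen (grading K) l)
include hX hl h

theorem reg_le_degree : X.reg ≤ (X.degree : EReal) := by
  have := finite_functions hX
  have h1 := isRegularIdeal_finrank hl (evalAlgHom_self X hl (top_eq_preimage h))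
    (evalOn_surjective X hl (top_eq_preimage h))
  rw [← homogeneousIdeal_eq_formsIdeal hl h, ← degree_eq_finrank] at h1
  rw [natCast_eq_coe]
  exact reg_le h1

theorem exists_line_of_reg_eq_degree (hreg : X.reg = (X.degree : EReal)) :
    ∃ M : ClosedSubscheme K, M.IsLine ∧ X.LiesOn M := by
  have := finite_functions hX
  by_cases hinj : ∀ m ∈ grading K 1, evalAlgHom X hl (top_eq_preimage h) m = 0 → m = 0
  · have h1 := isRegularIdeal_finrank_sub_one hl (evalAlgHom_self X hl (top_eq_preimage h))
      (evalOn_surjective X hl (top_eq_preimage h)) hinj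
    rw [← homogeneousIdeal_eq_formsIdeal hl h, ← degree_eq_finrank] at h1
    have h2 := reg_le h1
    rw [hreg, natCast_eq_coe, EReal.coe_le_coe_iff, Int.cast_le] at h2
    lia
  · push Not at hinj
    obtain ⟨m, hm, hδm, hm0⟩ := hinj
    refine ⟨line m, line_isLine hm hm0, liesOn_line hm hm0 ?_⟩
    rw [← mem_idealOn_iff X hl h hm, ← dehom_eq_frac hl hm]
    exact (evalOn_eq_zero_iff X hl (top_eq_preimage h) m).mp hδm

theorem exists_line_of_reg_eq_degree_sub_one [IsAlgClosed K] (hl0 : l ≠ 0)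
    (hreg : X.reg = (X.degree : EReal) - 1) (hd : X.degree ≠ 4) :
    ∃ M : ClosedSubscheme K, M.IsLine ∧ (M.inter X).degree + 1 = X.degree := by
  have := finite_functions hX
  have hI : X.homogeneousIdeal = formsIdeal (evalAlgHom X hl (top_eq_preimage h)) :=
    homogeneousIdeal_eq_formsIdeal hl h
  have hδl := evalAlgHom_self X hl (top_eq_preimage h)
  have hsurj : Function.Surjective (evalAlgHom X hl (top_eq_preimage h)) :=
    evalOn_surjective X hl (top_eq_preimage h)
  have hcast : (X.degree : EReal) - 1 = ((((X.degree : ℤ) - 1 : ℤ) : ℝ) : EReal) := by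
    rw [natCast_eq_coe, Int.cast_sub, Int.cast_one]
    rfl
  rw [hcast] at hreg
  -- A linear form vanishing on `X` would force the regularity up to d.
  have hinj : ∀ m ∈ grading K 1, evalAlgHom X hl (top_eq_preimage h) m = 0 → m = 0 := by
    intro m hm hδm
    by_contra hm0
    have h1 := le_reg (X := X) (s := X.degree) fun r hr =>
      finrank_le_of_isRegularIdeal hl hδl hsurj hm hm0 hδm (hI ▸ hr)
    rw [hreg, EReal.coe_le_coe_iff, Int.cast_le] at h1
    lia
  rcases isRegularIdeal_or_exists_socle_element hl hδl hsurj hinj hd with h1 | h1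
  · rw [← hI, ← degree_eq_finrank] at h1
    have h2 := reg_le h1
    rw [hreg, EReal.coe_le_coe_iff, Int.cast_le] at h2
    lia
  · obtain ⟨m, hm, hδm, hsoc⟩ := h1
    have hm0 : m ≠ 0 := by
      rintro rfl
      exact hδm (map_zero _)
    exact ⟨line m, line_isLine hm hm0, degree_inter_line_add_one hX hl hm hl0 hm0 h hδm hsoc⟩

end Regularity
end Plane

end

theorem mainTheorem12 {K : Type u} [Field K] [IsAlgClosed K]
    (X : Plane.ClosedSubscheme K) (hX : X.IsFiniteScheme) (d : ℕ) (hd : X.degree = d) :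
    X.reg ≤ (d : EReal) ∧
    (X.reg = (d : EReal) → ∃ M : Plane.ClosedSubscheme K, M.IsLine ∧ X.LiesOn M) ∧
    (X.reg = (d : EReal) - 1 → d ≠ 4 →
      ∃ M : Plane.ClosedSubscheme K, M.IsLine ∧ ((M.inter X).degree : ℤ) = (d : ℤ) - 1) := by
  subst hd
  have : Infinite K := IsAlgClosed.instInfinite
  obtain ⟨l, hl, hl0, h⟩ := Plane.exists_linear_form hX
  refine ⟨Plane.reg_le_degree hX hl h, Plane.exists_line_of_reg_eq_degree hX hl h,
    fun hreg hd => ?_⟩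
  obtain ⟨M, hM, hdeg⟩ := Plane.exists_line_of_reg_eq_degree_sub_one hX hl h hl0 hreg hd
  exact ⟨M, hM, by lia⟩
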